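/- Let $G$ be a finite or infinite connected simple graph of maximum valence $3$, that is, every vertex has at most three neighbors and some vertex has exactly three. Suppose that $G$ contains a cycle and that its girth (the length of its shortest cycle) is at least $6$. Let $D(G)$ denote the distinguishing number of $G$, that is, the least number $k$ for which the vertices of $G$ can be colored with $k$ colors (not necessarily properly) so that the only automorphism of $G$ preserving all colors is the identity. Then $D(G)\le 2$; moreover, $D(G)=2$ if and only if $G$ has a non-identity automorphism. -/

import Mathlib

/-- `G` has maximum valence `d`: every vertex has at most `d` neighbors, and some vertex has
exactly `d` neighbors. The graph may be finite or infinite. -/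
def HasMaxValence {V : Type*} (G : SimpleGraph V) (d : ℕ) : Prop :=
  (∀ v, (G.neighborSet v).encard ≤ d) ∧ ∃ v, (G.neighborSet v).encard = d

/-- A (not necessarily proper) vertex coloring `c` of `G` is distinguishing if the only
automorphism of `G` that preserves the colors is the identity. -/
def IsDistinguishing {V C : Type*} (G : SimpleGraph V) (c : V → C) : Prop :=
  ∀ φ : G ≃g G, (∀ v, c (φ v) = c v) → ∀ v, φ v = v

/-- The distinguishing number `D(G)`: the least `k` for which there is a distinguishing coloring
of the vertices of `G` with `k` colors (and `⊤` if no finite number of colors suffices). -/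
noncomputable def distinguishingNumber {V : Type*} (G : SimpleGraph V) : ℕ∞ :=
  ⨅ (k : ℕ) (_ : ∃ c : V → Fin k, IsDistinguishing G c), (k : ℕ∞)

namespace SimpleGraph

variable {V : Type*} {G : SimpleGraph V}

/-! Sort the vertices into levels by their distance to a set `B` that an automorphism fixes
pointwise; the levels are then preserved. If all vertices up to level `n` are fixed, a vertex of
level `n + 1` that moves has the same parents as its image. As there are no 4-cycles, this is a
single parent, and the two vertices are twins. So an automorphism that fixes `B` and carries no
vertex to its twin is trivial (`IsLevel.eq_of_fixed`). Valence three makes twinship a matching, and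
any two matchings can be 2-colored at once (`exists_bool_coloring_of_pairings`). One matching is
thus left over to make `B` recognizable from the colors.

Taking `B` to be the 2-core reduces the theorem to minimum degree two. If all degrees are two, the
graph is a cycle. If some but not all are two, `B` is a single vertex of degree two, characterized
by the colors near it. The spare matching excludes impostors, or it separates vertices that lie
behind twins of degree two.

If the graph is cubic, `B` is a shortest cycle, colored black, with three white vertices attached to
it. The black vertices with only black neighbors that have a neighbor of the same kind form an arc
of the cycle (`IsFrame.isCore_iff`); the rest of the cycle is the only suitable path closing the arc
(`IsFrame.eq_of_black_path`), and the white attachments forbid a reflection. This needs one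
non-adjacency between attached vertices, which can fail only at girth 6. If it fails for every
6-cycle, the graph is the Heawood graph, and an explicit coloring works. -/

/-- Every vertex has at most three neighbors. -/
def IsSubcubic (G : SimpleGraph V) : Prop :=
  ∀ v a b c d, G.Adj v a → G.Adj v b → G.Adj v c → G.Adj v d →
    a = b ∨ a = c ∨ a = d ∨ b = c ∨ b = d ∨ c = d

/-- Two distinct vertices have at most one common neighbor. -/
def NoFourCycle (G : SimpleGraph V) : Prop :=
  ∀ a b x y, G.Adj a x → G.Adj b x → G.Adj a y → G.Adj b y → a = b ∨ x = y

theorem Connected.forall_of_adj_closed (hG : G.Connected) {P : V → Prop} {v₀ : V} (h₀ : P v₀)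
    (h : ∀ v w, G.Adj v w → P v → P w) (v : V) : P v := by
  obtain ⟨p⟩ := hG.preconnected v₀ v
  induction p with
  | nil => exact h₀
  | cons hadj _ ih => exact ih (h _ _ hadj h₀)

/-! ### Levels and twins -/

/-- `ℓ` is the function that measures the distance to the set `B`. -/
structure IsLevel (G : SimpleGraph V) (B : Set V) (ℓ : V → ℕ) : Prop where
  eq_zero_iff : ∀ v, ℓ v = 0 ↔ v ∈ B
  le_succ : ∀ v w, G.Adj v w → ℓ w ≤ ℓ v + 1
  exists_parent : ∀ v, ℓ v ≠ 0 → ∃ p, G.Adj p v ∧ ℓ p + 1 = ℓ v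

theorem Connected.exists_isLevel (hG : G.Connected) {B : Set V} (hB : B.Nonempty) :
    ∃ ℓ, IsLevel G B ℓ := by
  classical
  have hne : ∀ v, ∃ n, ∃ b ∈ B, G.dist b v = n := fun v => ⟨_, hB.some, hB.some_mem, rfl⟩
  have hle : ∀ v w, G.Adj v w → Nat.find (hne w) ≤ Nat.find (hne v) + 1 := by
    intro v w hvw
    obtain ⟨b, hb, hd⟩ := Nat.find_spec (hne v)
    refine (Nat.find_min' (hne w) ⟨b, hb, rfl⟩).trans ?_
    have := hG.dist_triangle (u := b) (v := v) (w := w)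
    rw [dist_eq_one_iff_adj.mpr hvw] at this
    omega
  refine ⟨fun v => Nat.find (hne v), ?_, hle, ?_⟩
  · intro v
    rw [Nat.find_eq_zero]
    constructor
    · rintro ⟨b, hb, hd⟩
      rwa [← hG.dist_eq_zero_iff.mp hd]
    · exact fun hv => ⟨v, hv, dist_self⟩
  · intro v hv
    obtain ⟨b, hb, hd⟩ := Nat.find_spec (hne v)
    obtain ⟨p, hp⟩ := hG.exists_walk_length_eq_dist v b
    cases p with
    | nil =>
      simp at hd
      exact absurd hd.symm hv
    | cons hadj q =>
      rename_i w
      refine ⟨w, hadj.symm, ?_⟩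
      have h1 := dist_le q
      rw [Walk.length_cons, dist_comm] at hp
      have h2 := Nat.find_min' (hne w) ⟨b, hb, rfl⟩
      rw [dist_comm] at h1
      have h3 := hle _ _ hadj.symm
      show Nat.find (hne w) + 1 = Nat.find (hne v)
      omega

namespace IsLevel

variable {B : Set V} {ℓ : V → ℕ}

/-- Descending along parents of `ℓ'` bounds `ℓ`. By symmetry a level function is unique, which is
why automorphisms preserving `B` preserve levels. -/
theorem le {ℓ' : V → ℕ} (h : IsLevel G B ℓ) (h' : IsLevel G B ℓ') (v : V) : ℓ v ≤ ℓ' v := by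
  induction hn : ℓ' v generalizing v with
  | zero => rw [(h.eq_zero_iff v).mpr ((h'.eq_zero_iff v).mp hn)]
  | succ n ih =>
    obtain ⟨p, hp, hl⟩ := h'.exists_parent v (by omega)
    have h1 := h.le_succ _ _ hp
    have h2 := ih p (by omega)
    omega

theorem map_iso (h : IsLevel G B ℓ) (φ : G ≃g G) (hφ : ∀ v, φ v ∈ B ↔ v ∈ B) (v : V) :
    ℓ (φ v) = ℓ v := by
  have h' : IsLevel G B (fun v => ℓ (φ v)) := by
    refine ⟨fun v => (h.eq_zero_iff _).trans (hφ v),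
      fun v w hvw => h.le_succ _ _ (φ.map_adj_iff.mpr hvw), fun v hv => ?_⟩
    obtain ⟨p, hp, hl⟩ := h.exists_parent _ hv
    refine ⟨φ.symm p, ?_, by simpa using hl⟩
    rw [← φ.map_adj_iff]
    simpa using hp
  exact le_antisymm (h'.le h v) (h.le h' v)

theorem map_iso_of_fixed (h : IsLevel G B ℓ) (φ : G ≃g G) (hφ : ∀ v ∈ B, φ v = v) (v : V) :
    ℓ (φ v) = ℓ v := by
  refine h.map_iso φ (fun v => ⟨fun hv => ?_, fun hv => by rwa [hφ v hv]⟩) v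
  have := φ.injective (hφ _ hv)
  rwa [this] at hv

end IsLevel

/-- `p` is the only neighbor of `u` on the level that precedes the one of `u`. -/
def OnlyParent (G : SimpleGraph V) (ℓ : V → ℕ) (p u : V) : Prop :=
  G.Adj p u ∧ ℓ p + 1 = ℓ u ∧ ∀ q, G.Adj q u → ℓ q + 1 = ℓ u → q = p

/-- Distinct vertices with the same only parent. -/
def Twin (G : SimpleGraph V) (ℓ : V → ℕ) (u w : V) : Prop :=
  u ≠ w ∧ ∃ p, OnlyParent G ℓ p u ∧ OnlyParent G ℓ p w

theorem Twin.symm {ℓ : V → ℕ} {u w : V} (h : Twin G ℓ u w) : Twin G ℓ w u :=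
  ⟨h.1.symm, h.2.imp fun _ hp => hp.symm⟩

theorem Twin.level_eq {ℓ : V → ℕ} {u w : V} (h : Twin G ℓ u w) : ℓ u = ℓ w := by
  obtain ⟨_, p, h1, h2⟩ := h
  rw [← h1.2.1, ← h2.2.1]

theorem Twin.level_pos {ℓ : V → ℕ} {u w : V} (h : Twin G ℓ u w) : 0 < ℓ u := by
  obtain ⟨_, p, h1, h2⟩ := h
  rw [← h1.2.1]
  omega

theorem OnlyParent.sibling {ℓ : V → ℕ} {p u w : V} (h : OnlyParent G ℓ p u) (ht : Twin G ℓ u w) :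
    OnlyParent G ℓ p w := by
  obtain ⟨_, q, h1, h2⟩ := ht
  rwa [h.2.2 q h1.1 h1.2.1] at h2

/-- Off `B` one of the three edges at `p` leads to a parent, which leaves at most two children. On
`B` this bound is the hypothesis `hB`. -/
theorem IsLevel.twin_unique {B : Set V} {ℓ : V → ℕ} (h : IsLevel G B ℓ) (hG : G.IsSubcubic)
    (hB : ∀ p ∈ B, ∀ a b c, G.Adj p a → G.Adj p b → G.Adj p c → a ∉ B → b ∉ B → c ∉ B →
      a = b ∨ a = c ∨ b = c) {u v w : V} (hv : Twin G ℓ u v) (hw : Twin G ℓ u w) : v = w := by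
  by_contra hne
  obtain ⟨p, hpu, hpv⟩ := hv.2
  have hpw := hpu.sibling hw
  have hu1 := hpu.2.1
  have hv1 := hpv.2.1
  have hw1 := hpw.2.1
  have h1 := hv.1
  have h2 := hw.1
  by_cases hp : p ∈ B
  · have hnot : ∀ x, ℓ p + 1 = ℓ x → x ∉ B := fun x hx hxB => by
      rw [(h.eq_zero_iff x).mpr hxB] at hx
      omega
    rcases hB p hp u v w hpu.1 hpv.1 hpw.1 (hnot _ hu1) (hnot _ hv1) (hnot _ hw1) with h | h | h
    exacts [h1 h, h2 h, hne h]
  · obtain ⟨q, hq, hql⟩ := h.exists_parent p (fun h0 => hp ((h.eq_zero_iff p).mp h0))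
    have hqne : ∀ x, ℓ p + 1 = ℓ x → q ≠ x := by
      rintro x hx rfl
      omega
    rcases hG p u v w q hpu.1 hpv.1 hpw.1 hq.symm with h | h | h | h | h | h
    exacts [h1 h, h2 h, hqne u hu1 h.symm, hne h, hqne v hv1 h.symm, hqne w hw1 h.symm]

/-- The parents of `u` are fixed, so they are also the parents of `φ u`. Two of them would form a
4-cycle with `u` and `φ u`. -/
theorem twin_of_fixed_below {ℓ : V → ℕ} {B : Set V} (hℓ : IsLevel G B ℓ) (h4 : G.NoFourCycle)
    (φ : G ≃g G) (hφ : ∀ v, ℓ (φ v) = ℓ v) {n : ℕ} (hn : ∀ v, ℓ v ≤ n → φ v = v) {u : V}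
    (hu : ℓ u = n + 1) : φ u = u ∨ Twin G ℓ u (φ u) := by
  by_contra! hcon
  obtain ⟨hne, htw⟩ := hcon
  obtain ⟨p, hp, hpl⟩ := hℓ.exists_parent u (by omega)
  have key : ∀ q, ℓ q = n → (G.Adj q (φ u) ↔ G.Adj q u) := by
    intro q hq
    conv_lhs => rw [← hn q hq.le]
    exact φ.map_adj_iff
  have hpφ := (key p (by omega)).mpr hp
  have huniq : ∀ q, G.Adj q u → ℓ q = n → q = p := by
    intro q hq hql
    rcases h4 q p u (φ u) hq hp ((key q hql).mpr hq) hpφ with h | h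
    exacts [h, absurd h.symm hne]
  refine htw ⟨fun h => hne h.symm, p, ⟨hp, hpl, fun q hq hql => huniq q hq (by omega)⟩,
    hpφ, by rw [hφ, hpl], fun q hq hql => ?_⟩
  rw [hφ, hu] at hql
  have hql' : ℓ q = n := by omega
  exact huniq q ((key q hql').mp hq) hql'

theorem IsLevel.eq_of_fixed {ℓ : V → ℕ} {B : Set V} (hℓ : IsLevel G B ℓ) (h4 : G.NoFourCycle)
    (φ : G ≃g G) (hφ : ∀ v ∈ B, φ v = v) (ht : ∀ u, ¬ Twin G ℓ u (φ u)) (v : V) : φ v = v := by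
  suffices h : ∀ n v, ℓ v ≤ n → φ v = v from h _ v le_rfl
  intro n
  induction n with
  | zero => exact fun v hv => hφ v ((hℓ.eq_zero_iff v).mp (by omega))
  | succ n ih =>
    intro v hv
    rcases hv.lt_or_eq with hv | hv
    · exact ih v (by omega)
    · exact (twin_of_fixed_below hℓ h4 φ (hℓ.map_iso_of_fixed φ hφ) ih hv).resolve_right (ht v)

/-! ### Matchings and 2-colorings -/

/-- A symmetric irreflexive relation in which every element has at most one partner. -/
structure IsPairing {X : Type*} (R : X → X → Prop) : Prop where
  symm : ∀ x y, R x y → R y x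
  ne : ∀ x y, R x y → x ≠ y
  unique : ∀ x y z, R x y → R x z → y = z

/-- The edges `{x, α x}` and `{x, β x}` form even cycles and two-way infinite paths. The color
classes of each component are orbits of `β * α`: both `α` and `β` exchange an orbit with the other
one of its component. -/
theorem exists_bool_coloring_of_involutions {X : Type*} (α β : Equiv.Perm X) (hα : α * α = 1)
    (hβ : β * β = 1) (hα' : ∀ x, α x ≠ x) (hβ' : ∀ x, β x ≠ x) :
    ∃ c : X → Bool, ∀ x, c (α x) ≠ c x ∧ c (β x) ≠ c x := by
  classical
  set f : Equiv.Perm X := β * α with hf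
  have hαi : α⁻¹ = α := inv_eq_of_mul_eq_one_left hα
  have hβi : β⁻¹ = β := inv_eq_of_mul_eq_one_left hβ
  have hfi : f⁻¹ = α * β := by rw [hf, mul_inv_rev, hαi, hβi]
  have hconj : ∀ k : ℤ, α * f ^ k = f ^ (-k) * α := by
    intro k
    have h1 : α * f * α⁻¹ = f⁻¹ := by rw [hfi, hf, hαi]; simp only [mul_assoc, hα, mul_one]
    have h2 : (α * f * α⁻¹) ^ k = α * f ^ k * α⁻¹ := conj_zpow
    rw [h1, inv_zpow'] at h2
    rw [h2, hαi, mul_assoc, hα, mul_one]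
  have hβf : β = f * α := by rw [hf, mul_assoc, hα, mul_one]
  -- If `f ^ j` sent `x` to `α x`, the midpoint of this stretch would be a fixed point of `α` (even
  -- `j`) or of `β` (odd `j`).
  have hnot : ∀ x, ¬ f.SameCycle x (α x) := by
    rintro x ⟨j, hj⟩
    obtain ⟨k, hk | hk⟩ := Int.even_or_odd' j
    · apply hα' ((f ^ k) x)
      have := congrArg (fun g : Equiv.Perm X => g x) (hconj k)
      simp only [Equiv.Perm.mul_apply] at this
      rw [this, ← hj, ← Equiv.Perm.mul_apply, ← zpow_add]
      congr 2; omega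
    · apply hβ' ((f ^ (k + 1)) x)
      have := congrArg (fun g : Equiv.Perm X => g x) (hconj (k + 1))
      simp only [Equiv.Perm.mul_apply] at this
      rw [hβf, Equiv.Perm.mul_apply, this, ← hj, ← Equiv.Perm.mul_apply, ← zpow_one_add,
        ← Equiv.Perm.mul_apply, ← zpow_add]
      congr 2; omega
  have hαc : ∀ x y, f.SameCycle x y → f.SameCycle (α x) (α y) := by
    rintro x y ⟨k, hk⟩
    refine ⟨-k, ?_⟩
    rw [← hk, ← Equiv.Perm.mul_apply, ← hconj, Equiv.Perm.mul_apply]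
  let s := Equiv.Perm.SameCycle.setoid f
  let q : X → Quotient s := Quotient.mk s
  -- Any linear order on the orbits serves to choose one orbit from each pair.
  let : LinearOrder (Quotient s) := linearOrderOfSTO WellOrderingRel
  have hαα : ∀ x, α (α x) = x := fun x => by
    rw [← Equiv.Perm.mul_apply, hα, Equiv.Perm.one_apply]
  have hqne : ∀ x, q x ≠ q (α x) := fun x h => hnot x (Quotient.exact h)
  have hcongr : ∀ x y, q x = q y → q (α x) = q (α y) := fun x y h =>
    Quotient.sound (hαc _ _ (Quotient.exact h))
  have hmain : ∀ x y, q y = q (α x) →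
      decide (q y < q (α y)) ≠ decide (q x < q (α x)) := by
    intro x y h
    have h' : q (α y) = q x := by rw [hcongr _ _ h, hαα]
    rw [h, h']
    intro hd
    rw [decide_eq_decide] at hd
    rcases lt_or_gt_of_ne (hqne x) with hlt | hlt
    · exact lt_asymm hlt (hd.mpr hlt)
    · exact lt_asymm hlt (hd.mp hlt)
  refine ⟨fun x => decide (q x < q (α x)), fun x => ⟨hmain x _ rfl, hmain x _ ?_⟩⟩
  rw [hβf]
  exact Quotient.sound ⟨-1, by simp⟩

/-- Doubling the set removes fixed points: an unpaired element is exchanged with its own copy. -/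
theorem IsPairing.exists_perm {X : Type*} {R : X → X → Prop} (hR : IsPairing R) :
    ∃ α : Equiv.Perm (X × Bool), α * α = 1 ∧ (∀ x, α x ≠ x) ∧
      ∀ x y, R x y → ∀ b, α (x, b) = (y, b) := by
  classical
  let g : X × Bool → X × Bool := fun x =>
    if h : ∃ y, R x.1 y then (h.choose, x.2) else (x.1, !x.2)
  have hg : ∀ x y, R x y → ∀ b, g (x, b) = (y, b) := by
    intro x y hxy b
    have h : ∃ y, R x y := ⟨y, hxy⟩
    simp only [g, dif_pos h]
    rw [hR.unique _ _ _ h.choose_spec hxy]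
  have hg' : ∀ x, (¬ ∃ y, R x y) → ∀ b, g (x, b) = (x, !b) := by
    intro x h b
    simp only [g, dif_neg h]
  have hinv : Function.Involutive g := by
    rintro ⟨x, b⟩
    by_cases h : ∃ y, R x y
    · obtain ⟨y, hy⟩ := h
      rw [hg x y hy, hg y x (hR.symm _ _ hy)]
    · rw [hg' x h, hg' x h, Bool.not_not]
  refine ⟨hinv.toPerm, Equiv.ext hinv, ?_, hg⟩
  rintro ⟨x, b⟩
  show g (x, b) ≠ (x, b)
  by_cases h : ∃ y, R x y
  · obtain ⟨y, hy⟩ := h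
    rw [hg x y hy]
    exact fun h => hR.ne _ _ hy (congrArg Prod.fst h).symm
  · rw [hg' x h]
    simp

theorem exists_bool_coloring_of_pairings {X : Type*} {R S : X → X → Prop} (hR : IsPairing R)
    (hS : IsPairing S) :
    ∃ c : X → Bool, (∀ x y, R x y → c x ≠ c y) ∧ ∀ x y, S x y → c x ≠ c y := by
  obtain ⟨α, hα, hα', hαR⟩ := hR.exists_perm
  obtain ⟨β, hβ, hβ', hβS⟩ := hS.exists_perm
  obtain ⟨c, hc⟩ := exists_bool_coloring_of_involutions α β hα hβ hα' hβ'
  refine ⟨fun x => c (x, true), fun x y h => ?_, fun x y h => ?_⟩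
  · have := (hc (x, true)).1
    rw [hαR x y h] at this
    exact this.symm
  · have := (hc (x, true)).2
    rw [hβS x y h] at this
    exact this.symm

/-- By Zorn's lemma, a matching inside the graph `L` extends to a maximal one; maximality means that
every edge of `L` has a matched endpoint. -/
theorem IsPairing.exists_maximal {X : Type*} {R L : X → X → Prop} (hR : IsPairing R)
    (hRL : ∀ x y, R x y → L x y) (hL : ∀ x y, L x y → L y x) (hL' : ∀ x y, L x y → x ≠ y) :
    ∃ N : X → X → Prop, IsPairing N ∧ (∀ x y, R x y → N x y) ∧ (∀ x y, N x y → L x y) ∧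
      ∀ x y, L x y → ∃ z, N x z ∨ N y z := by
  let S : Set (Set (X × X)) := {A | IsPairing (fun x y => (x, y) ∈ A) ∧ ∀ x y, (x, y) ∈ A → L x y}
  have hR0 : {q : X × X | R q.1 q.2} ∈ S := ⟨hR, hRL⟩
  obtain ⟨M, hRM, hM⟩ := zorn_subset_nonempty S (by
    intro C hC hchain hne
    refine ⟨⋃₀ C, ⟨⟨?_, ?_, ?_⟩, ?_⟩, fun s hs => Set.subset_sUnion_of_mem hs⟩
    · rintro x y ⟨A, hA, h⟩
      exact ⟨A, hA, (hC hA).1.symm _ _ h⟩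
    · rintro x y ⟨A, hA, h⟩
      exact (hC hA).1.ne _ _ h
    · rintro x y z ⟨A, hA, h⟩ ⟨A', hA', h'⟩
      rcases hchain.total hA hA' with hs | hs
      · exact (hC hA').1.unique _ _ _ (hs h) h'
      · exact (hC hA).1.unique _ _ _ h (hs h')
    · rintro x y ⟨A, hA, h⟩
      exact (hC hA).2 _ _ h) _ hR0
  refine ⟨fun x y => (x, y) ∈ M, hM.prop.1, fun x y h => hRM h, hM.prop.2, fun x y hxy => ?_⟩
  by_contra! hcon
  have hnew : M ∪ {(x, y), (y, x)} ∈ S := by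
    have hne := hL' x y hxy
    refine ⟨⟨?_, ?_, ?_⟩, ?_⟩
    · rintro a b (h | h | h)
      · exact Or.inl (hM.prop.1.symm _ _ h)
      · simp only [Prod.mk.injEq] at h
        obtain ⟨rfl, rfl⟩ := h
        exact Or.inr (Or.inr rfl)
      · simp only [Set.mem_singleton_iff, Prod.mk.injEq] at h
        obtain ⟨rfl, rfl⟩ := h
        exact Or.inr (Or.inl rfl)
    · rintro a b (h | h | h)
      · exact hM.prop.1.ne _ _ h
      · simp only [Prod.mk.injEq] at h
        obtain ⟨rfl, rfl⟩ := h
        exact hne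
      · simp only [Set.mem_singleton_iff, Prod.mk.injEq] at h
        obtain ⟨rfl, rfl⟩ := h
        exact hne.symm
    · intro a b d h h'
      simp only [Set.mem_union, Set.mem_insert_iff, Set.mem_singleton_iff, Prod.mk.injEq] at h h'
      have hu := hM.prop.1.unique a b d
      have h1 := fun z => (hcon z).1
      have h2 := fun z => (hcon z).2
      grind
    · rintro a b (h | h | h)
      · exact hM.prop.2 _ _ h
      · simp only [Prod.mk.injEq] at h
        obtain ⟨rfl, rfl⟩ := h
        exact hxy
      · simp only [Set.mem_singleton_iff, Prod.mk.injEq] at h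
        obtain ⟨rfl, rfl⟩ := h
        exact hL _ _ hxy
  have := hM.le_of_ge hnew Set.subset_union_left (Or.inr (Or.inl rfl))
  exact (hcon y).1 this

/-! ### Graphs with vertices of degree two -/

/-- The vertex `v` has exactly two neighbors. -/
def DegTwo (G : SimpleGraph V) (v : V) : Prop :=
  ∃ a b, a ≠ b ∧ ∀ w, G.Adj v w ↔ w = a ∨ w = b

/-- The vertex `v` has exactly three neighbors. -/
def DegThree (G : SimpleGraph V) (v : V) : Prop :=
  ∃ a b c, a ≠ b ∧ a ≠ c ∧ b ≠ c ∧ ∀ w, G.Adj v w ↔ w = a ∨ w = b ∨ w = c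

/-- Every vertex has at least two neighbors. -/
def MinDegTwo (G : SimpleGraph V) : Prop :=
  ∀ v, ∃ a b, a ≠ b ∧ G.Adj v a ∧ G.Adj v b

theorem DegTwo.eq {v a b c : V} (h : G.DegTwo v) (ha : G.Adj v a) (hb : G.Adj v b)
    (hc : G.Adj v c) : a = b ∨ a = c ∨ b = c := by
  obtain ⟨x, y, _, h⟩ := h
  rw [h] at ha hb hc
  grind

theorem DegTwo.map_iso {v : V} (h : G.DegTwo v) (φ : G ≃g G) : G.DegTwo (φ v) := by
  obtain ⟨x, y, hne, h⟩ := h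
  refine ⟨φ x, φ y, φ.injective.ne hne, fun w => ?_⟩
  obtain ⟨w, rfl⟩ := φ.surjective w
  rw [φ.map_adj_iff, h, φ.injective.eq_iff, φ.injective.eq_iff]

theorem degTwo_map_iso_iff {v : V} (φ : G ≃g G) : G.DegTwo (φ v) ↔ G.DegTwo v :=
  ⟨fun h => by simpa using h.map_iso φ.symm, fun h => h.map_iso φ⟩

theorem MinDegTwo.degThree (h2 : G.MinDegTwo) (h3 : G.IsSubcubic) {v : V} (hv : ¬ G.DegTwo v) :
    G.DegThree v := by
  obtain ⟨a, b, hab, ha, hb⟩ := h2 v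
  have : ∃ c, G.Adj v c ∧ c ≠ a ∧ c ≠ b := by
    by_contra! hcon
    refine hv ⟨a, b, hab, fun w => ⟨fun hw => ?_, ?_⟩⟩
    · by_cases h : w = a
      exacts [Or.inl h, Or.inr (hcon w hw h)]
    · rintro (rfl | rfl) <;> assumption
  obtain ⟨c, hc, hca, hcb⟩ := this
  refine ⟨a, b, c, hab, hca.symm, hcb.symm, fun w => ⟨fun hw => ?_, ?_⟩⟩
  · have := h3 v a b c w ha hb hc hw
    grind
  · rintro (rfl | rfl | rfl) <;> assumption

theorem IsLevel.twin_isPairing {B : Set V} {ℓ : V → ℕ} (h : IsLevel G B ℓ) (hG : G.IsSubcubic)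
    (hB : ∀ p ∈ B, ∀ a b c, G.Adj p a → G.Adj p b → G.Adj p c → a ∉ B → b ∉ B → c ∉ B →
      a = b ∨ a = c ∨ b = c) : IsPairing (Twin G ℓ) :=
  ⟨fun _ _ h => h.symm, fun _ _ h => h.1, fun _ _ _ hv hw => h.twin_unique hG hB hv hw⟩

theorem not_degTwo_of_onlyParent {B : Set V} {ℓ : V → ℕ} (hℓ : IsLevel G B ℓ) {p u w : V}
    (hne : u ≠ w) (hu : OnlyParent G ℓ p u) (hw : OnlyParent G ℓ p w) (hp : ℓ p ≠ 0) :
    ¬ G.DegTwo p := by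
  intro h
  obtain ⟨q, hq, hql⟩ := hℓ.exists_parent p hp
  have h1 := hu.2.1
  have h2 := hw.2.1
  rcases h.eq hu.1 hw.1 hq.symm with h | h | h
  · exact hne h
  · subst h; omega
  · subst h; omega

theorem Connected.exists_degTwo_between (hG : G.Connected) {x y z : V} (hx : G.DegTwo x)
    (hy : G.DegTwo y) (hxy : G.Adj x y) (hz : ¬ G.DegTwo z) :
    ∃ r s t, G.DegTwo r ∧ G.Adj r s ∧ G.Adj r t ∧ ¬ G.DegTwo s ∧ G.DegTwo t := by
  by_contra! hcon
  have := hG.forall_of_adj_closed (P := fun v => G.DegTwo v ∧ ∃ w, G.Adj v w ∧ G.DegTwo w)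
    ⟨hx, y, hxy, hy⟩ (fun v w hvw ⟨hv, u, hvu, hu⟩ =>
      ⟨by by_contra hw; exact hcon v w u hv hvw hvu hw hu, v, hvw.symm, hv⟩) z
  exact hz this.1

/-- The vertices `r`, `s`, `t` are black; beyond level 1 only one of each pair of twins is black.
The spare matching joins adjacent vertices of degree two on the same level. Then `r` is the only
black vertex of degree two with a black neighbor of degree two and a black neighbor not of degree
two. -/
theorem exists_isDistinguishing_of_adj_degTwo (hG : G.Connected) (h3 : G.IsSubcubic)
    (h4 : G.NoFourCycle) (htri : ∀ a b c, G.Adj a b → G.Adj b c → ¬ G.Adj a c) {r s t : V}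
    (hr : G.DegTwo r) (hs : G.Adj r s) (ht : G.Adj r t) (hs2 : ¬ G.DegTwo s) (ht2 : G.DegTwo t) :
    ∃ c : V → Bool, IsDistinguishing G c := by
  classical
  obtain ⟨ℓ, hℓ⟩ := hG.exists_isLevel (Set.singleton_nonempty r)
  have hst : s ≠ t := by rintro rfl; exact hs2 ht2
  have hnr : ∀ w, G.Adj r w → w = s ∨ w = t := fun w hw => by
    have := hr.eq hs ht hw
    grind
  have hℓ0 : ∀ v, ℓ v = 0 ↔ v = r := fun v => by simpa using hℓ.eq_zero_iff v
  have hℓr : ℓ r = 0 := (hℓ0 r).mpr rfl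
  have hℓ1 : ∀ v, G.Adj r v → ℓ v = 1 := fun v hv => by
    have h1 := hℓ.le_succ r v hv
    have h2 : ℓ v ≠ 0 := fun h => hv.ne' ((hℓ0 v).mp h)
    omega
  have hℓ1' : ∀ v, ℓ v = 1 → v = s ∨ v = t := fun v hv => by
    obtain ⟨p, hp, hpl⟩ := hℓ.exists_parent v (by omega)
    rw [(hℓ0 p).mp (by omega)] at hp
    exact hnr v hp
  have hR : IsPairing (Twin G ℓ) := by
    refine hℓ.twin_isPairing h3 ?_
    rintro p rfl a b c ha hb hc - - -
    exact hr.eq ha hb hc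
  have hS : IsPairing (fun x y => G.Adj x y ∧ ℓ x = ℓ y ∧ G.DegTwo x ∧ G.DegTwo y) := by
    refine ⟨fun x y h => ⟨h.1.symm, h.2.1.symm, h.2.2.2, h.2.2.1⟩, fun x y h => h.1.ne, ?_⟩
    rintro x y z ⟨hxy, hl, hx, -⟩ ⟨hxz, hl', -, -⟩
    have h0 : ℓ x ≠ 0 := by
      intro h0
      apply hxy.ne
      rw [(hℓ0 x).mp h0, (hℓ0 y).mp (hl ▸ h0)]
    obtain ⟨p, hp, hpl⟩ := hℓ.exists_parent x h0
    rcases hx.eq hxy hxz hp.symm with h | h | h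
    · exact h
    · subst h; omega
    · subst h; omega
  obtain ⟨c₀, hc₀, hc₀'⟩ := exists_bool_coloring_of_pairings hR hS
  let c : V → Bool := fun v =>
    if ℓ v ≤ 1 then true else if ∃ w, Twin G ℓ v w then c₀ v else false
  have hc1 : ∀ v, ℓ v ≤ 1 → c v = true := fun v hv => by simp [c, hv]
  have hc2 : ∀ v, 2 ≤ ℓ v → c v = true → (∃ w, Twin G ℓ v w) ∧ c₀ v = true := fun v hv h => by
    have : ¬ ℓ v ≤ 1 := by omega
    simpa [c, this] using h
  have hct : ∀ v w, Twin G ℓ v w → 2 ≤ ℓ v → c v ≠ c w := fun v w h hv => by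
    have h1 : ¬ ℓ v ≤ 1 := by omega
    have h2 : ¬ ℓ w ≤ 1 := by rw [← h.level_eq]; omega
    simpa [c, h1, h2, show ∃ w, Twin G ℓ v w from ⟨w, h⟩,
      show ∃ v, Twin G ℓ w v from ⟨v, h.symm⟩] using hc₀ v w h
  have hroot : ∀ q q₁ q₂, G.DegTwo q → G.Adj q q₁ → G.Adj q q₂ → G.DegTwo q₁ → ¬ G.DegTwo q₂ →
      c q = true → c q₁ = true → c q₂ = true → q = r := by
    intro q q₁ q₂ hq hq1 hq2 hd1 hd2 hcq hcq1 hcq2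
    by_contra hqr
    have hlq : ℓ q ≠ 0 := fun h => hqr ((hℓ0 q).mp h)
    by_cases hq' : ℓ q = 1
    · rcases hℓ1' q hq' with h | h
      · exact hs2 (h ▸ hq)
      · subst h
        have hq2r : ℓ q₂ ≠ 0 := by
          rw [Ne, hℓ0]
          rintro rfl
          exact hd2 hr
        have hl2 := hℓ.le_succ _ _ hq2
        have hl2' : ℓ q₂ ≠ 1 := fun h => by
          rcases hℓ1' q₂ h with h | h
          · exact htri r q q₂ ht hq2 (h ▸ hs)
          · exact hq2.ne h.symm
        obtain ⟨⟨w, hw⟩, -⟩ := hc2 q₂ (by omega) hcq2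
        obtain ⟨hqw, p, hpq, hpw⟩ := hw
        rw [← hpq.2.2 q hq2 (by omega)] at hpw
        have hlw := hpw.2.1
        rcases hq.eq hq2 hpw.1 ht.symm with h | h | h
        -- Here `q = t` would have three neighbors: `r`, `q₂` and the twin of `q₂`.
        · exact hqw h
        · exact hq2r (h ▸ hℓr)
        · rw [h] at hlw
          omega
    · obtain ⟨⟨w, hw⟩, hcq0⟩ := hc2 q (by omega) hcq
      obtain ⟨hqw, p, hpq, hpw⟩ := hw
      have h1 := hpq.2.1
      have hpd := not_degTwo_of_onlyParent hℓ hqw hpq hpw (by omega)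
      have hpq1 : p ≠ q₁ := by rintro rfl; exact hpd hd1
      have hll := hℓ.le_succ q q₁ hq1
      have hll' := hℓ.le_succ q₁ q hq1.symm
      have hne1 : ℓ q₁ + 1 ≠ ℓ q := fun h => hpq1 (hpq.2.2 q₁ hq1.symm h).symm
      obtain ⟨⟨w', hw'⟩, hcq0'⟩ := hc2 q₁ (by omega) hcq1
      obtain ⟨hqw', p', hpq', hpw'⟩ := hw'
      have h1' := hpq'.2.1
      have hpd' := not_degTwo_of_onlyParent hℓ hqw' hpq' hpw' (by omega)
      have hne2 : ℓ q + 1 ≠ ℓ q₁ := fun h => by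
        rw [← hpq'.2.2 q hq1 h] at hpd'
        exact hpd' hq
      -- Both `q` and `q₁` are black and so have twins. Hence neither is the parent of the other:
      -- the only parent of twins has degree three off the root. They lie on one level and the spare
      -- matching separates them.
      exact hc₀' q q₁ ⟨hq1, by omega, hq, hd1⟩ (hcq0.trans hcq0'.symm)
  refine ⟨c, fun φ hφ => ?_⟩
  have hφr : φ r = r := by
    refine hroot (φ r) (φ t) (φ s) (hr.map_iso φ) (φ.map_adj_iff.mpr ht) (φ.map_adj_iff.mpr hs)
      (ht2.map_iso φ) (by rwa [degTwo_map_iso_iff]) ?_ ?_ ?_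
    · rw [hφ, hc1 r (by omega)]
    · rw [hφ, hc1 t (hℓ1 t ht).le]
    · rw [hφ, hc1 s (hℓ1 s hs).le]
  refine hℓ.eq_of_fixed h4 φ (by simpa using hφr) fun u hu => ?_
  have hpos := hu.level_pos
  rcases Nat.lt_or_ge 1 (ℓ u) with h | h
  · exact hct u _ hu h (hφ u).symm
  · rcases hℓ1' u (by omega) with rfl | rfl
    · rcases hℓ1' (φ u) (by rw [← hu.level_eq]; omega) with h' | h'
      · exact hu.1 h'.symm
      · exact hs2 ((degTwo_map_iso_iff φ).mp (h' ▸ ht2))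
    · rcases hℓ1' (φ u) (by rw [← hu.level_eq]; omega) with h' | h'
      · exact hs2 (h' ▸ ht2.map_iso φ)
      · exact hu.1 h'.symm

/-- `x` is reached from `p` by descending through a vertex with exactly two neighbors. -/
def Descends (G : SimpleGraph V) (ℓ : V → ℕ) (p x : V) : Prop :=
  ∃ u, G.DegTwo u ∧ G.Adj p u ∧ G.Adj u x ∧ ℓ u = ℓ p + 1 ∧ ℓ x = ℓ p + 2

theorem Descends.map_iso {ℓ : V → ℕ} {p x : V} (h : Descends G ℓ p x) (φ : G ≃g G)
    (hφ : ∀ v, ℓ (φ v) = ℓ v) : Descends G ℓ (φ p) (φ x) := by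
  obtain ⟨u, hu, hpu, hux, hl, hl'⟩ := h
  exact ⟨φ u, hu.map_iso φ, φ.map_adj_iff.mpr hpu, φ.map_adj_iff.mpr hux, by simp only [hφ, hl],
    by simp only [hφ, hl']⟩

/-- A vertex `p` off `B` has at most two children, and each child of degree two leads to at most one
vertex below it. -/
theorem isPairing_descends {B : Set V} {ℓ : V → ℕ} (hℓ : IsLevel G B ℓ) (h3 : G.IsSubcubic) :
    IsPairing (fun x y => x ≠ y ∧ (∀ p, Descends G ℓ p x ↔ Descends G ℓ p y) ∧
      ∃ p, ℓ p ≠ 0 ∧ Descends G ℓ p x) := by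
  refine ⟨fun x y ⟨h, hp, p, hp0, hd⟩ => ⟨h.symm, fun p => (hp p).symm, p, hp0, (hp p).mp hd⟩,
    fun x y h => h.1, ?_⟩
  rintro x y z ⟨hxy, hpy, p, hp0, hx⟩ ⟨hxz, hpz, -⟩
  by_contra hyz
  have hy := (hpy p).mp hx
  have hz := (hpz p).mp hx
  obtain ⟨q, hq, hql⟩ := hℓ.exists_parent p hp0
  have key : ∀ x y u, x ≠ y → G.DegTwo u → G.Adj p u → G.Adj u x → G.Adj u y →
      ℓ x = ℓ p + 2 → ℓ y = ℓ p + 2 → False := by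
    intro x y u hne hu hpu hux huy hlx hly
    rcases hu.eq hpu.symm hux huy with h | h | h
    · subst h; omega
    · subst h; omega
    · exact hne h
  obtain ⟨u, hu, hpu, hux, hlu, hlx⟩ := hx
  obtain ⟨v, hv, hpv, hvy, hlv, hly⟩ := hy
  obtain ⟨w, hw, hpw, hwz, hlw, hlz⟩ := hz
  have hqne : ∀ a, ℓ a = ℓ p + 1 → a ≠ q := by
    rintro a ha rfl
    omega
  rcases h3 p u v w q hpu hpv hpw hq.symm with h | h | h | h | h | h
  · exact key x y u hxy hu hpu hux (h ▸ hvy) hlx hly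
  · exact key x z u hxz hu hpu hux (h ▸ hwz) hlx hlz
  · exact hqne u hlu h
  · exact key y z v hyz hv hpv hvy (h ▸ hwz) hly hlz
  · exact hqne v hlv h
  · exact hqne w hlw h

/-- The root is recognized as the only black vertex of degree two. Twins of degree two are then both
white, so they must be told apart by their further neighbors; the spare matching does this when
those neighbors are one level below. -/
theorem exists_isDistinguishing_of_isolated_degTwo (hG : G.Connected) (h2 : G.MinDegTwo)
    (h3 : G.IsSubcubic) (h4 : G.NoFourCycle)
    (hiso : ∀ x y, G.DegTwo x → G.Adj x y → ¬ G.DegTwo y) {r : V} (hr : G.DegTwo r) :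
    ∃ c : V → Bool, IsDistinguishing G c := by
  classical
  obtain ⟨s, t, hst, hs, ht⟩ := h2 r
  obtain ⟨ℓ, hℓ⟩ := hG.exists_isLevel (Set.singleton_nonempty r)
  have hnr : ∀ w, G.Adj r w → w = s ∨ w = t := fun w hw => by
    have := hr.eq hs ht hw
    grind
  have hℓ0 : ∀ v, ℓ v = 0 ↔ v = r := fun v => by simpa using hℓ.eq_zero_iff v
  have hℓ1' : ∀ v, ℓ v = 1 → v = s ∨ v = t := fun v hv => by
    obtain ⟨p, hp, hpl⟩ := hℓ.exists_parent v (by omega)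
    rw [(hℓ0 p).mp (by omega)] at hp
    exact hnr v hp
  have hR : IsPairing (Twin G ℓ) := by
    refine hℓ.twin_isPairing h3 ?_
    rintro p rfl a b c ha hb hc - - -
    exact hr.eq ha hb hc
  obtain ⟨c₀, hc₀, hc₀'⟩ := exists_bool_coloring_of_pairings hR (isPairing_descends hℓ h3)
  let c : V → Bool := fun v =>
    if G.DegTwo v then decide (v = r) else if ℓ v ≤ 1 then decide (v = s) else c₀ v
  have hc2 : ∀ v, ¬ G.DegTwo v → 2 ≤ ℓ v → c v = c₀ v := fun v hv hl => by
    simp [c, hv, show ¬ ℓ v ≤ 1 by omega]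
  refine ⟨c, fun φ hφ => ?_⟩
  have hφr : φ r = r := by
    have h := hφ r
    simpa [c, hr, hr.map_iso φ] using h
  have hφℓ := hℓ.map_iso_of_fixed φ (by simpa using hφr)
  have hφst : ∀ v, G.Adj r v → φ v = v := by
    have hsd := hiso r s hr hs
    have htd := hiso r t hr ht
    have hl : ∀ v, G.Adj r v → ℓ v ≤ 1 := fun v hv => by
      have := hℓ.le_succ r v hv
      rwa [(hℓ0 r).mpr rfl] at this
    have hmap : ∀ v, G.Adj r v → φ v = s ∨ φ v = t := fun v hv => by
      apply hnr
      rw [← hφr]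
      exact φ.map_adj_iff.mpr hv
    have hcs : c s = true := by simp [c, hsd, hl s hs]
    have hct : c t = false := by simp [c, htd, hl t ht, hst.symm]
    intro v hv
    rcases hnr v hv with rfl | rfl
    · exact (hmap v hv).resolve_right fun h => by
        have := hφ v
        rw [h, hcs, hct] at this
        exact absurd this (by decide)
    · exact (hmap v hv).resolve_left fun h => by
        have := hφ v
        rw [h, hcs, hct] at this
        exact absurd this (by decide)
  -- The induction starts at level 1, already settled by the colors of `s` and `t`. So the parent
  -- `p` below has nonzero level, as the spare matching requires.
  suffices h : ∀ n v, ℓ v ≤ n + 1 → φ v = v from fun v => h (ℓ v) v (by omega)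
  intro n
  induction n with
  | zero =>
    intro v hv
    by_cases h0 : ℓ v = 0
    · rwa [(hℓ0 v).mp h0]
    · apply hφst
      rcases hℓ1' v (by omega) with rfl | rfl <;> assumption
  | succ n ih =>
    intro u hu
    rcases hu.lt_or_eq with hu | hu
    · exact ih u (by omega)
    refine (twin_of_fixed_below hℓ h4 φ hφℓ ih hu).resolve_right fun htw => ?_
    have hctw : ∀ x, ¬ G.DegTwo x → ℓ x = n + 2 → ¬ Twin G ℓ x (φ x) := fun x hx hl htw => by
      apply hc₀ x (φ x) htw
      rw [← hc2 x hx (by omega), ← hc2 (φ x) (by rwa [degTwo_map_iso_iff]) (by rw [hφℓ]; omega), hφ]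
    by_cases hud : G.DegTwo u
    swap
    · exact hctw u hud hu htw
    obtain ⟨huw, p, hpu, hpw⟩ := htw
    have hpl := hpu.2.1
    have hφp : φ p = p := ih p (by omega)
    obtain ⟨x, hux, hxp⟩ : ∃ x, G.Adj u x ∧ x ≠ p := by
      obtain ⟨a, b, hab, ha, hb⟩ := h2 u
      by_cases h : a = p
      · exact ⟨b, hb, fun h' => hab (h.trans h'.symm)⟩
      · exact ⟨a, ha, h⟩
    have hxd := hiso u x hud hux
    have hφx : G.Adj (φ u) (φ x) := φ.map_adj_iff.mpr hux
    have hxne : φ x ≠ x := fun h => by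
      rw [h] at hφx
      rcases h4 u (φ u) p x hpu.1.symm hpw.1.symm hux hφx with h | h
      exacts [huw h, hxp h.symm]
    have hl1 := hℓ.le_succ u x hux
    have hl2 := hℓ.le_succ x u hux.symm
    have hl3 : ℓ x + 1 ≠ ℓ u := fun h => hxp (hpu.2.2 x hux.symm h)
    by_cases hlx : ℓ x = n + 2
    -- On the level of `u`, the moved vertex `x` is itself a twin of its image and is not of degree
    -- two.
    · exact hctw x hxd hlx ((twin_of_fixed_below hℓ h4 φ hφℓ ih hlx).resolve_left hxne)
    · have hlx' : ℓ x = n + 3 := by omega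
      refine hc₀' x (φ x) ⟨hxne.symm, fun q => ?_, p, by omega, u, hud, hpu.1, hux, by omega,
        by omega⟩ ?_
      · constructor
        · intro h
          have hq : φ q = q := by
            obtain ⟨v, -, -, -, -, hl⟩ := h
            exact ih q (by omega)
          rw [← hq]
          exact h.map_iso φ hφℓ
        · intro h
          have hq : φ q = q := by
            obtain ⟨v, -, -, -, -, hl⟩ := h
            rw [hφℓ] at hl
            exact ih q (by omega)
          rw [← hq] at h
          have := h.map_iso φ.symm fun v => by rw [← hφℓ (φ.symm v), φ.apply_symm_apply]
          simpa using this
      · rw [← hc2 x hxd (by omega), ← hc2 (φ x) (by rwa [degTwo_map_iso_iff]) (by rw [hφℓ]; omega),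
          hφ]

/-! ### Cycles and girth -/

/-- `f 0, …, f (n - 1)` are the consecutive vertices of a cycle of length `n`. -/
structure IsCyc (G : SimpleGraph V) (n : ℕ) (f : ℕ → V) : Prop where
  three_le : 3 ≤ n
  inj : ∀ i < n, ∀ j < n, f i = f j → i = j
  adj : ∀ i, i + 1 < n → G.Adj (f i) (f (i + 1))
  close : G.Adj (f (n - 1)) (f 0)

/-- All cycles have length at least `6`. -/
def GirthSix (G : SimpleGraph V) : Prop := ∀ n f, IsCyc G n f → 6 ≤ n

theorem isCyc_of_list (x : V) (l : List V) (h3 : 3 ≤ l.length) (hn : l.Nodup)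
    (hc : l.IsChain G.Adj) (hl : ∀ h : l ≠ [], G.Adj (l.getLast h) (l.head h)) :
    IsCyc G l.length (fun i => l.getD i x) := by
  have hget : ∀ i (h : i < l.length), l.getD i x = l[i] := fun i h => by simp [h]
  refine ⟨h3, fun i hi j hj h => ?_, fun i hi => ?_, ?_⟩
  · simp only [hget i hi, hget j hj] at h
    exact (hn.getElem_inj_iff).mp h
  · simp only [hget i (by omega), hget (i + 1) hi]
    exact List.isChain_iff_getElem.mp hc i hi
  · have hne : l ≠ [] := by rintro rfl; simp at h3
    have := hl hne
    simp only [hget (l.length - 1) (by omega), hget 0 (by omega)]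
    rwa [List.getLast_eq_getElem, List.head_eq_getElem] at this

theorem GirthSix.not_adj (h : G.GirthSix) {a b c : V} (hab : G.Adj a b) (hbc : G.Adj b c) :
    ¬ G.Adj a c := by
  intro hac
  have := h _ _ (isCyc_of_list a [a, b, c] (by simp)
    (by simp [hab.ne, hbc.ne, hac.ne]) (by simp [hab, hbc]) (by simpa using hac.symm))
  simp at this

theorem GirthSix.noFourCycle (h : G.GirthSix) : G.NoFourCycle := by
  intro a b x y hax hbx hay hby
  by_contra! hne
  have := h _ _ (isCyc_of_list a [a, x, b, y] (by simp)
    (by simp [hax.ne, hay.ne, hne.1, hne.2, hbx.ne', hby.ne]) (by simp [hax, hbx.symm, hby])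
    (by simpa using hay.symm))
  simp at this

theorem GirthSix.not_pentagon (h : G.GirthSix) {a b c d e : V} (hab : G.Adj a b) (hbc : G.Adj b c)
    (hcd : G.Adj c d) (hde : G.Adj d e) (hac : a ≠ c) (had : a ≠ d) (hbd : b ≠ d) (hbe : b ≠ e)
    (hce : c ≠ e) : ¬ G.Adj e a := by
  intro hea
  have := h _ _ (isCyc_of_list a [a, b, c, d, e] (by simp)
    (by simp [hab.ne, hbc.ne, hcd.ne, hde.ne, hea.ne', *]) (by simp [*]) (by simpa using hea))
  simp at this

theorem DegTwo.fixed {v w x : V} (hw : G.DegTwo w) (φ : G ≃g G) (hφw : φ w = w) (hφv : φ v = v)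
    (hv : G.Adj w v) (hx : G.Adj w x) : φ x = x := by
  have h : G.Adj w (φ x) := by
    rw [← hφw]
    exact φ.map_adj_iff.mpr hx
  by_cases hxv : x = v
  · rw [hxv, hφv]
  · rcases hw.eq hv hx h with h | h | h
    · exact absurd h.symm hxv
    · exact absurd (φ.injective (h.symm.trans hφv.symm)) hxv
    · exact h.symm

/-- Black `f 3` has no black neighbor, so it is fixed. Of `f 0` and `f 1` only `f 1` is at distance
two from it, as `n ≥ 6`. Fixing an adjacent pair fixes everything by connectedness. -/
theorem exists_isDistinguishing_of_forall_degTwo (hG : G.Connected) (h2 : ∀ v, G.DegTwo v) {n : ℕ}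
    {f : ℕ → V} (hf : IsCyc G n f) (hn : 6 ≤ n) : ∃ c : V → Bool, IsDistinguishing G c := by
  classical
  refine ⟨fun v => decide (v = f 0 ∨ v = f 1 ∨ v = f 3), fun φ hφ => ?_⟩
  have hne : ∀ i j, i < n → j < n → i ≠ j → f i ≠ f j := fun i j hi hj hij h =>
    hij (hf.inj i hi j hj h)
  have hnbr : ∀ i, 0 < i → i + 1 < n → ∀ w, G.Adj (f i) w → w = f (i - 1) ∨ w = f (i + 1) := by
    intro i hi hin w hw
    have h1 := hf.adj (i - 1) (by omega)
    rw [Nat.sub_add_cancel hi] at h1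
    rcases (h2 (f i)).eq h1.symm (hf.adj i hin) hw with h | h | h
    · exact absurd h (hne _ _ (by omega) hin (by omega))
    · exact Or.inl h.symm
    · exact Or.inr h.symm
  have hnbr0 : ∀ w, G.Adj (f 0) w → w = f (n - 1) ∨ w = f 1 := by
    intro w hw
    rcases (h2 (f 0)).eq hf.close.symm (hf.adj 0 (by omega)) hw with h | h | h
    · exact absurd h (hne _ _ (by omega) (by omega) (by omega))
    · exact Or.inl h.symm
    · exact Or.inr h.symm
  have hmap : ∀ v, (φ v = f 0 ∨ φ v = f 1 ∨ φ v = f 3) ↔ (v = f 0 ∨ v = f 1 ∨ v = f 3) :=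
    fun v => decide_eq_decide.mp (hφ v)
  have hwhite : ∀ i, i < n → i ≠ 0 → i ≠ 1 → i ≠ 3 → ¬ (f i = f 0 ∨ f i = f 1 ∨ f i = f 3) := by
    rintro i hi h0 h1 h3 (h | h | h)
    exacts [hne _ _ hi (by omega) h0 h, hne _ _ hi (by omega) h1 h, hne _ _ hi (by omega) h3 h]
  have hadj : ∀ v w, G.Adj (φ v) w → G.Adj v (φ.symm w) := fun v w h => by
    rw [← φ.map_adj_iff]
    simpa using h
  have hiso : ∀ w, G.Adj (φ (f 3)) w → ¬ (w = f 0 ∨ w = f 1 ∨ w = f 3) := by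
    intro w hw hcon
    have h := hadj _ _ hw
    rw [← φ.apply_symm_apply w, hmap] at hcon
    rcases hnbr 3 (by omega) (by omega) _ h with h | h <;> rw [h] at hcon
    · exact hwhite 2 (by omega) (by omega) (by omega) (by omega) hcon
    · exact hwhite 4 (by omega) (by omega) (by omega) (by omega) hcon
  have h01 := hf.adj 0 (by omega)
  have h3 : φ (f 3) = f 3 := by
    rcases (hmap (f 3)).mpr (by simp) with h | h | h
    · exact absurd (Or.inr (Or.inl rfl)) (hiso (f 1) (by rwa [h]))
    · exact absurd (Or.inl rfl) (hiso (f 0) (by rw [h]; exact h01.symm))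
    · exact h
  have h1 : φ (f 1) = f 1 := by
    rcases (hmap (f 1)).mpr (by simp) with h | h | h
    · have ha : G.Adj (f 0) (φ (f 2)) := by
        rw [← h]
        exact φ.map_adj_iff.mpr (hf.adj 1 (by omega))
      have hb : G.Adj (f 3) (φ (f 2)) := by
        rw [← h3]
        exact φ.map_adj_iff.mpr (hf.adj 2 (by omega)).symm
      rcases hnbr0 _ ha with h | h <;> rcases hnbr 3 (by omega) (by omega) _ hb with h' | h' <;>
        exact absurd (h.symm.trans h') (hne _ _ (by omega) (by omega) (by omega))
    · exact h
    · exact absurd (φ.injective (h.trans h3.symm)) (hne _ _ (by omega) (by omega) (by omega))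
  have h0 : φ (f 0) = f 0 := by
    rcases (hmap (f 0)).mpr (by simp) with h | h | h
    · exact h
    · exact absurd (φ.injective (h.trans h1.symm)) (hne _ _ (by omega) (by omega) (by omega))
    · exact absurd (φ.injective (h.trans h3.symm)) (hne _ _ (by omega) (by omega) (by omega))
  intro v
  refine (hG.forall_of_adj_closed (P := fun v => φ v = v ∧ ∀ w, G.Adj v w → φ w = w)
    ⟨h0, fun w hw => (h2 (f 0)).fixed φ h0 h1 h01 hw⟩ ?_ v).1
  rintro v w hvw ⟨hv, hv'⟩
  exact ⟨hv' w hvw, fun x hx => (h2 w).fixed φ (hv' w hvw) hv hvw.symm hx⟩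

/-! ### Shortest cycles in cubic graphs -/

/-- The predecessor of `i` modulo `g`. -/
def cycPred (g i : ℕ) : ℕ := if i = 0 then g - 1 else i - 1

/-- The successor of `i` modulo `g`. -/
def cycSucc (g i : ℕ) : ℕ := if i + 1 = g then 0 else i + 1

/-- A shortest cycle `c` of a cubic graph; `u i` is the neighbor of `c i` outside the cycle. -/
structure IsFrame (G : SimpleGraph V) (g : ℕ) (c u : ℕ → V) : Prop where
  six_le : 6 ≤ g
  inj : ∀ i < g, ∀ j < g, c i = c j → i = j
  adj_iff : ∀ i < g, ∀ w, G.Adj (c i) w ↔ w = c (cycPred g i) ∨ w = c (cycSucc g i) ∨ w = u i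
  side_ne : ∀ i < g, ∀ j < g, u i ≠ c j
  side_inj : ∀ i < g, ∀ j < g, u i = u j → i = j
  side_adj : ∀ i j, i < j → j < g → G.Adj (u i) (u j) → g = 6 ∧ j = i + 3

theorem IsCyc.chord {g : ℕ} {c : ℕ → V} (hc : IsCyc G g c)
    (hmin : ∀ n f, IsCyc G n f → g ≤ n) {i j : ℕ} (hij : i < j) (hj : j < g)
    (h : G.Adj (c i) (c j)) : j = i + 1 ∨ (i = 0 ∧ j = g - 1) := by
  by_contra! hcon
  have : IsCyc G (j - i + 1) (fun m => c (i + m)) := by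
    refine ⟨by omega, fun a ha b hb hab => ?_, fun a ha => hc.adj _ (by omega), ?_⟩
    · have := hc.inj _ (by omega) _ (by omega) hab
      omega
    · simpa [show i + (j - i) = j by omega] using h.symm
  have := hmin _ _ this
  omega

theorem IsCyc.le_of_common {g : ℕ} {c : ℕ → V} (hc : IsCyc G g c)
    (hmin : ∀ n f, IsCyc G n f → g ≤ n) {i j : ℕ} (hij : i < j) (hj : j < g) {x : V}
    (hi : G.Adj (c i) x) (hjx : G.Adj (c j) x) (hx : ∀ k < g, x ≠ c k) : g ≤ j - i + 2 := by
  refine hmin _ (fun m => if m ≤ j - i then c (i + m) else x) ⟨by omega, ?_, ?_, ?_⟩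
  · intro a ha b hb hab
    split_ifs at hab
    · have := hc.inj _ (by omega) _ (by omega) hab
      omega
    · exact absurd hab.symm (hx _ (by omega))
    · exact absurd hab (hx _ (by omega))
    · omega
  · intro a ha
    split_ifs
    · exact hc.adj _ (by omega)
    · rwa [show i + a = j by omega]
    · omega
    · omega
  · simpa [show ¬ (j - i + 2 - 1 ≤ j - i) by omega] using hi.symm

/-- The arc from `c i` to `c j` closes up through `y` and `x` to a cycle of length `j - i + 3`. -/
theorem IsCyc.le_of_bridge {g : ℕ} {c : ℕ → V} (hc : IsCyc G g c)
    (hmin : ∀ n f, IsCyc G n f → g ≤ n) {i j : ℕ} (hij : i < j) (hj : j < g) {x y : V}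
    (hi : G.Adj (c i) x) (hjy : G.Adj (c j) y) (hxy : G.Adj x y) (hx : ∀ k < g, x ≠ c k)
    (hy : ∀ k < g, y ≠ c k) : g ≤ j - i + 3 := by
  refine hmin _ (fun m => if m ≤ j - i then c (i + m) else if m = j - i + 1 then y else x)
    ⟨by omega, ?_, ?_, ?_⟩
  · intro a ha b hb hab
    split_ifs at hab
    · have := hc.inj _ (by omega) _ (by omega) hab
      omega
    · exact absurd hab.symm (hy _ (by omega))
    · exact absurd hab.symm (hx _ (by omega))
    · exact absurd hab (hy _ (by omega))
    · omega
    · exact absurd hab hxy.ne'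
    · exact absurd hab (hx _ (by omega))
    · exact absurd hab hxy.ne
    · omega
  · intro a ha
    split_ifs
    all_goals first
      | omega
      | exact hc.adj _ (by omega)
      | rwa [show i + a = j by omega]
      | exact hxy.symm
  · simpa [show ¬ (j - i + 3 - 1 ≤ j - i) by omega, show j - i + 3 - 1 ≠ j - i + 1 by omega]
      using hi.symm

theorem DegThree.exists_third {v a b : V} (h : G.DegThree v) (ha : G.Adj v a) (hb : G.Adj v b)
    (hab : a ≠ b) : ∃ c, c ≠ a ∧ c ≠ b ∧ ∀ w, G.Adj v w ↔ w = a ∨ w = b ∨ w = c := by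
  obtain ⟨x, y, z, hxy, hxz, hyz, h⟩ := h
  have hyx := hxy.symm
  have hzx := hxz.symm
  have hzy := hyz.symm
  rw [h] at ha hb
  rcases ha with rfl | rfl | rfl <;> rcases hb with rfl | rfl | rfl
  all_goals first
    | exact absurd rfl hab
    | exact ⟨x, hxy, hxz, fun w => (h w).trans (by tauto)⟩
    | exact ⟨x, hxz, hxy, fun w => (h w).trans (by tauto)⟩
    | exact ⟨y, hyx, hyz, fun w => (h w).trans (by tauto)⟩
    | exact ⟨y, hyz, hyx, fun w => (h w).trans (by tauto)⟩
    | exact ⟨z, hzx, hzy, fun w => (h w).trans (by tauto)⟩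
    | exact ⟨z, hzy, hzx, fun w => (h w).trans (by tauto)⟩

theorem IsCyc.exists_isFrame {g : ℕ} {c : ℕ → V} (hc : IsCyc G g c)
    (hmin : ∀ n f, IsCyc G n f → g ≤ n) (h6 : G.GirthSix) (hcub : ∀ v, G.DegThree v) :
    ∃ u, IsFrame G g c u := by
  have hg := h6 g c hc
  have h4 := h6.noFourCycle
  have hpred : ∀ i < g, G.Adj (c i) (c (cycPred g i)) := by
    intro i hi
    unfold cycPred
    split_ifs with h
    · rw [h]
      exact hc.close.symm
    · have := hc.adj (i - 1) (by omega)
      rw [show i - 1 + 1 = i by omega] at this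
      exact this.symm
  have hsucc : ∀ i < g, G.Adj (c i) (c (cycSucc g i)) := by
    intro i hi
    unfold cycSucc
    split_ifs with h
    · have := hc.close
      rwa [show g - 1 = i by omega] at this
    · exact hc.adj i (by omega)
  have hpl : ∀ i < g, cycPred g i < g := fun i hi => by unfold cycPred; split_ifs <;> omega
  have hsl : ∀ i < g, cycSucc g i < g := fun i hi => by unfold cycSucc; split_ifs <;> omega
  have hps : ∀ i < g, cycPred g i ≠ cycSucc g i := fun i hi => by
    unfold cycPred cycSucc
    split_ifs <;> omega
  have hex : ∀ i, ∃ x, i < g → x ≠ c (cycPred g i) ∧ x ≠ c (cycSucc g i) ∧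
      ∀ w, G.Adj (c i) w ↔ w = c (cycPred g i) ∨ w = c (cycSucc g i) ∨ w = x := by
    intro i
    by_cases hi : i < g
    swap
    · exact ⟨c 0, fun h => absurd h hi⟩
    have hne : c (cycPred g i) ≠ c (cycSucc g i) := fun h =>
      hps i hi (hc.inj _ (hpl i hi) _ (hsl i hi) h)
    exact ((hcub (c i)).exists_third (hpred i hi) (hsucc i hi) hne).imp fun x hx _ => hx
  choose u hu using hex
  have hadj : ∀ i < g, G.Adj (c i) (u i) := fun i hi => ((hu i hi).2.2 _).mpr (Or.inr (Or.inr rfl))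
  have hside : ∀ i < g, ∀ j < g, u i ≠ c j := by
    intro i hi j hj h
    have h1 := hadj i hi
    obtain ⟨hp, hs, -⟩ := hu i hi
    rw [h] at h1 hp hs
    have hp' : j ≠ cycPred g i := fun h => hp (h ▸ rfl)
    have hs' : j ≠ cycSucc g i := fun h => hs (h ▸ rfl)
    unfold cycPred at hp'
    unfold cycSucc at hs'
    rcases lt_trichotomy i j with hij | hij | hij
    · rcases hc.chord hmin hij hj h1 with h | h <;> split_ifs at hp' hs' <;> omega
    · subst hij
      exact h1.ne rfl
    · rcases hc.chord hmin hij hi h1.symm with h | h <;> split_ifs at hp' hs' <;> omega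
  have hinj : ∀ i j, i < j → j < g → u i ≠ u j := by
    intro i j hij hj h
    have h1 := hadj i (by omega)
    have h2 := hadj j hj
    rw [← h] at h2
    have hx := hside i (by omega)
    have hle := hc.le_of_common hmin hij hj h1 h2 hx
    have key : ∀ m < g, G.Adj (c i) (c m) → G.Adj (c j) (c m) → False := by
      intro m hm hi' hj'
      rcases h4 _ _ _ _ h1 h2 hi' hj' with h | h
      · exact absurd (hc.inj _ (by omega) _ hj h) (by omega)
      · exact hx m hm h
    have hpi := hpred i (by omega)
    have hpj := hsucc j hj
    unfold cycPred at hpi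
    unfold cycSucc at hpj
    have hcase : (i = 0 ∧ j = g - 1) ∨ (i = 0 ∧ j = g - 2) ∨ (i = 1 ∧ j = g - 1) := by omega
    rcases hcase with ⟨rfl, rfl⟩ | ⟨rfl, rfl⟩ | ⟨rfl, rfl⟩
    · exact h6.not_adj h1 h2.symm hc.close.symm
    · rw [if_pos rfl] at hpi
      rw [if_neg (by omega), show g - 2 + 1 = g - 1 by omega] at hpj
      exact key (g - 1) (by omega) hpi hpj
    · rw [if_neg (by omega)] at hpi
      rw [if_pos (by omega)] at hpj
      exact key 0 (by omega) hpi hpj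
  refine ⟨u, hg, hc.inj, fun i hi w => (hu i hi).2.2 w, hside, ?_, ?_⟩
  · intro i hi j hj h
    rcases lt_trichotomy i j with hij | hij | hij
    exacts [absurd h (hinj i j hij hj), hij, absurd h.symm (hinj j i hij hi)]
  · intro i j hij hj h
    have h1 := hadj i (by omega)
    have h2 := hadj j hj
    have hle := hc.le_of_bridge hmin hij hj h1 h2 h (hside i (by omega)) (hside j hj)
    have hcne : ∀ a b, a < g → b < g → a ≠ b → c a ≠ c b := fun a b ha hb hab h =>
      hab (hc.inj a ha b hb h)
    have huu := hinj i j hij hj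
    have hp1 := hpred i (by omega)
    have hpl1 := hpl i (by omega)
    have hp2 := hpred _ hpl1
    have hpl2 := hpl _ hpl1
    -- The other arc between `c i` and `c j` has length 1, 2 or 3 and closes up to a 4-, 5- or
    -- 6-cycle. Only the last is possible, and it forces `g = 6`.
    have hcase : j = i + (g - 1) ∨ j = i + (g - 2) ∨ j = i + (g - 3) := by omega
    rcases hcase with hj' | hj' | hj'
    · have he : cycPred g i = j := by unfold cycPred; split_ifs <;> omega
      rw [he] at hp1
      rcases h4 (u i) (c j) (c i) (u j) h1.symm hp1.symm h h2 with h | h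
      · exact absurd h (hside i (by omega) j hj)
      · exact absurd h.symm (hside j hj i (by omega))
    · have he : cycPred g (cycPred g i) = j := by unfold cycPred; split_ifs <;> omega
      have hne : i ≠ cycPred g i := by unfold cycPred; split_ifs <;> omega
      rw [he] at hp2
      exact absurd h1.symm (h6.not_pentagon hp1 hp2 h2 h.symm
        (hcne _ _ (by omega) hj (by omega)) (hside j hj i (by omega)).symm
        (hside j hj _ hpl1).symm (hside i (by omega) _ hpl1).symm
        (hside i (by omega) _ hj).symm)
    · have he : cycPred g (cycPred g (cycPred g i)) = j := by unfold cycPred; split_ifs <;> omega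
      have hne : i ≠ cycPred g (cycPred g i) := by unfold cycPred; split_ifs <;> omega
      have hne' : cycPred g i ≠ j := by unfold cycPred; split_ifs <;> omega
      have hp3 := hpred _ hpl2
      rw [he] at hp3
      have hcyc := isCyc_of_list (G := G) (c i)
        [c i, c (cycPred g i), c (cycPred g (cycPred g i)), c j, u j, u i] (by simp)
        (by
          have a1 := hcne i _ (by omega) hpl2 hne
          have a2 := hcne _ _ hpl1 hj hne'
          have a3 := hcne i j (by omega) hj (by omega)
          have b1 := fun k hk => (hside i (by omega) k hk).symm
          have b2 := fun k hk => (hside j hj k hk).symm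
          have hi : i < g := by omega
          simp [hp1.ne, hp2.ne, hp3.ne, a1, a2, a3, b1, b2, huu.symm, hi, hj, hpl1, hpl2])
        (by simp [hp1, hp2, hp3, h2, h.symm]) (by simpa using h1.symm)
      have := hmin _ _ hcyc
      simp only [List.length_cons, List.length_nil] at this
      omega

/-! ### The coloring around a shortest cycle -/

/-- A coloring that singles out the cycle `c` of a frame, where `ℓ` measures the distance to `c`:
the cycle is black, three of the vertices `u i` are white, and twins have different colors. -/
structure IsFrameColoring (G : SimpleGraph V) (g : ℕ) (c u : ℕ → V) (ℓ : V → ℕ) (col : V → Bool) :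
    Prop where
  cycle : ∀ i < g, col (c i) = true
  side : ∀ i < g, (col (u i) = true ↔ i ≠ 0 ∧ i ≠ 1 ∧ i ≠ 3)
  exists_twin : ∀ v, 2 ≤ ℓ v → col v = true → ∃ w, Twin G ℓ v w
  twin_ne : ∀ v w, 2 ≤ ℓ v → Twin G ℓ v w → col v ≠ col w
  cross : ∀ x y, G.Adj x y → ℓ x = 2 → ℓ y = 2 → G.Adj x (u (g - 1)) → G.Adj y (u 4) →
    col x = true → col y = false
  maximal : ∀ x y, G.Adj x y → 2 ≤ ℓ x → ℓ x = ℓ y → col x = true → col y = true →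
    ∃ z, (G.Adj x z ∨ G.Adj y z) ∧ col z = false

/-- A black vertex all of whose neighbors are black. -/
def IsFull (G : SimpleGraph V) (col : V → Bool) (v : V) : Prop :=
  col v = true ∧ ∀ w, G.Adj v w → col w = true

theorem IsFull.map_iso {col : V → Bool} {v : V} (h : IsFull G col v) (φ : G ≃g G)
    (hφ : ∀ v, col (φ v) = col v) : IsFull G col (φ v) := by
  refine ⟨(hφ v).trans h.1, fun w hw => ?_⟩
  obtain ⟨w, rfl⟩ := φ.surjective w
  rw [hφ]
  exact h.2 w (φ.map_adj_iff.mp hw)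

/-- A full vertex that has a full neighbor. -/
def IsCore (G : SimpleGraph V) (col : V → Bool) (v : V) : Prop :=
  IsFull G col v ∧ ∃ w, G.Adj v w ∧ IsFull G col w

theorem IsCore.map_iso {col : V → Bool} {v : V} (h : IsCore G col v) (φ : G ≃g G)
    (hφ : ∀ v, col (φ v) = col v) : IsCore G col (φ v) := by
  obtain ⟨hv, w, hvw, hw⟩ := h
  exact ⟨hv.map_iso φ hφ, φ w, φ.map_adj_iff.mpr hvw, hw.map_iso φ hφ⟩

namespace IsFrame

variable {g : ℕ} {c u : ℕ → V} {ℓ : V → ℕ} {col : V → Bool}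

theorem adj_side (h : IsFrame G g c u) {i : ℕ} (hi : i < g) : G.Adj (c i) (u i) :=
  (h.adj_iff i hi _).mpr (Or.inr (Or.inr rfl))

theorem adj_succ (h : IsFrame G g c u) {i : ℕ} (hi : i + 1 < g) : G.Adj (c i) (c (i + 1)) := by
  rw [h.adj_iff i (by omega), cycSucc, if_neg (by omega)]
  exact Or.inr (Or.inl rfl)

theorem adj_close (h : IsFrame G g c u) : G.Adj (c (g - 1)) (c 0) := by
  have := h.six_le
  rw [h.adj_iff _ (by omega), cycSucc, if_pos (by omega)]
  exact Or.inr (Or.inl rfl)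

theorem eq_of_side_adj (h : IsFrame G g c u) {i j : ℕ} (hi : i < g) (hj : j < g)
    (ha : G.Adj (u i) (c j)) : j = i := by
  have h6 := h.six_le
  rcases (h.adj_iff j hj _).mp ha.symm with h' | h' | h'
  · exact absurd h' (h.side_ne i hi _ (by unfold cycPred; split_ifs <;> omega))
  · exact absurd h' (h.side_ne i hi _ (by unfold cycSucc; split_ifs <;> omega))
  · exact (h.side_inj i hi j hj h').symm

theorem side_adj_cases (h : IsFrame G g c u) {i j : ℕ} (hi : i < g) (hj : j < g)
    (ha : G.Adj (u i) (u j)) : g = 6 ∧ (j = i + 3 ∨ i = j + 3) := by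
  rcases lt_trichotomy i j with hij | hij | hij
  · have := h.side_adj i j hij hj ha
    exact ⟨this.1, Or.inl this.2⟩
  · subst hij
    exact absurd rfl ha.ne
  · have := h.side_adj j i hij hi ha.symm
    exact ⟨this.1, Or.inr this.2⟩

theorem adj_inner (h : IsFrame G g c u) {i : ℕ} (hi : 0 < i) (hig : i + 1 < g) (w : V) :
    G.Adj (c i) w ↔ w = c (i - 1) ∨ w = c (i + 1) ∨ w = u i := by
  rw [h.adj_iff i (by omega), cycPred, cycSucc, if_neg (by omega), if_neg (by omega)]

theorem adj_zero (h : IsFrame G g c u) (w : V) :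
    G.Adj (c 0) w ↔ w = c (g - 1) ∨ w = c 1 ∨ w = u 0 := by
  have := h.six_le
  rw [h.adj_iff 0 (by omega), cycPred, cycSucc, if_pos rfl, if_neg (by omega)]

theorem adj_last (h : IsFrame G g c u) (w : V) :
    G.Adj (c (g - 1)) w ↔ w = c (g - 2) ∨ w = c 0 ∨ w = u (g - 1) := by
  have := h.six_le
  rw [h.adj_iff _ (by omega), cycPred, cycSucc, if_neg (by omega), if_pos (by omega),
    show g - 1 - 1 = g - 2 by omega]

section Level

variable (h : IsFrame G g c u) (hℓ : IsLevel G {v | ∃ i < g, v = c i} ℓ)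
include hℓ

theorem level_cycle {i : ℕ} (hi : i < g) : ℓ (c i) = 0 := (hℓ.eq_zero_iff _).mpr ⟨i, hi, rfl⟩

include h

theorem level_side {i : ℕ} (hi : i < g) : ℓ (u i) = 1 := by
  have h1 := hℓ.le_succ _ _ (h.adj_side hi)
  rw [level_cycle hℓ hi] at h1
  have h2 : ℓ (u i) ≠ 0 := fun h0 => by
    obtain ⟨j, hj, hij⟩ := (hℓ.eq_zero_iff _).mp h0
    exact h.side_ne i hi j hj hij
  omega

theorem eq_side_of_adj {i : ℕ} (hi : i < g) {w : V} (hw : G.Adj (c i) w) (hw0 : ℓ w ≠ 0) :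
    w = u i := by
  have h6 := h.six_le
  rcases (h.adj_iff i hi w).mp hw with h' | h' | h'
  · rw [h', level_cycle hℓ (by unfold cycPred; split_ifs <;> omega)] at hw0
    exact absurd rfl hw0
  · rw [h', level_cycle hℓ (by unfold cycSucc; split_ifs <;> omega)] at hw0
    exact absurd rfl hw0
  · exact h'

theorem exists_side_of_level {v : V} (hv : ℓ v = 1) : ∃ i < g, v = u i := by
  obtain ⟨p, hp, hpl⟩ := hℓ.exists_parent v (by omega)
  obtain ⟨i, hi, rfl⟩ := (hℓ.eq_zero_iff p).mp (by omega)
  exact ⟨i, hi, h.eq_side_of_adj hℓ hi hp (by omega)⟩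

end Level

/-- The spare matching is a maximal matching `N` among the edges inside a level whose endpoints have
twins. It is chosen to contain the edges needed for `cross`, and its maximality yields `maximal`: an
endpoint of the edge is matched, and the partner of a black vertex is white. -/
theorem exists_isFrameColoring (h : IsFrame G g c u) (h3 : G.IsSubcubic) (h4 : G.NoFourCycle)
    (hℓ : IsLevel G {v | ∃ i < g, v = c i} ℓ) : ∃ col, IsFrameColoring G g c u ℓ col := by
  classical
  have h6 := h.six_le
  have hR : IsPairing (Twin G ℓ) := by
    refine hℓ.twin_isPairing h3 ?_
    rintro p ⟨i, hi, rfl⟩ x y z hx hy - hxB hyB -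
    rw [← hℓ.eq_zero_iff] at hxB hyB
    exact Or.inl ((h.eq_side_of_adj hℓ hi hx hxB).trans (h.eq_side_of_adj hℓ hi hy hyB).symm)
  let L : V → V → Prop := fun x y =>
    G.Adj x y ∧ ℓ x = ℓ y ∧ (∃ w, Twin G ℓ x w) ∧ ∃ w, Twin G ℓ y w
  have hL : ∀ x y, L x y → L y x := fun x y ⟨h1, h2, h3, h4⟩ => ⟨h1.symm, h2.symm, h4, h3⟩
  -- A vertex with a twin has only one parent, so `u (g - 1)` and `u 4` cannot both be above it.
  have hboth : ∀ x y, L x y → ℓ x = 2 → G.Adj x (u (g - 1)) → ¬ G.Adj x (u 4) := by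
    rintro x y ⟨-, -, ⟨w, -, p, hp, -⟩, -⟩ hx h1 h2
    have := hp.2.2 _ h1.symm (by rw [h.level_side hℓ (by omega), hx])
    rw [← hp.2.2 _ h2.symm (by rw [h.level_side hℓ (by omega), hx])] at this
    have := h.side_inj _ (by omega) _ (by omega) this
    omega
  have hone : ∀ x y z i, i < g → L x y → L x z → ℓ x = 2 → G.Adj y (u i) → G.Adj z (u i) →
      y = z := by
    intro x y z i hi hxy hxz hx hy hz
    rcases h4 x (u i) y z hxy.1 hy.symm hxz.1 hz.symm with h' | h'
    · rw [h', h.level_side hℓ hi] at hx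
      omega
    · exact h'
  have hM : IsPairing (fun x y => L x y ∧ ℓ x = 2 ∧ ((G.Adj x (u (g - 1)) ∧ G.Adj y (u 4)) ∨
      (G.Adj x (u 4) ∧ G.Adj y (u (g - 1))))) := by
    refine ⟨fun x y ⟨hl, hx, hor⟩ => ⟨hL x y hl, hl.2.1 ▸ hx, ?_⟩, fun x y h => h.1.1.ne, ?_⟩
    · rcases hor with ⟨h1, h2⟩ | ⟨h1, h2⟩
      exacts [Or.inr ⟨h2, h1⟩, Or.inl ⟨h2, h1⟩]
    · rintro x y z ⟨hxy, hx, ⟨h1, h2⟩ | ⟨h1, h2⟩⟩ ⟨hxz, -, ⟨h1', h2'⟩ | ⟨h1', h2'⟩⟩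
      · exact hone x y z 4 (by omega) hxy hxz hx h2 h2'
      · exact absurd h1' (hboth x y hxy hx h1)
      · exact absurd h1 (hboth x y hxy hx h1')
      · exact hone x y z (g - 1) (by omega) hxy hxz hx h2 h2'
  obtain ⟨N, hN, hMN, hNL, hmax⟩ := hM.exists_maximal (fun x y h => h.1) hL (fun x y h => h.1.ne)
  obtain ⟨c₀, hc₀, hc₀'⟩ := exists_bool_coloring_of_pairings hR hN
  let col : V → Bool := fun v => if ℓ v = 0 then true else
    if ℓ v = 1 then decide (v ≠ u 0 ∧ v ≠ u 1 ∧ v ≠ u 3) else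
      if ∃ w, Twin G ℓ v w then c₀ v else false
  have hcol : ∀ v, 2 ≤ ℓ v → col v = true → (∃ w, Twin G ℓ v w) ∧ c₀ v = true := fun v hv hc => by
    simpa [col, show ℓ v ≠ 0 by omega, show ℓ v ≠ 1 by omega] using hc
  have hcolt : ∀ v w, 2 ≤ ℓ v → Twin G ℓ v w → col v = c₀ v := fun v w hv hw => by
    simp [col, show ℓ v ≠ 0 by omega, show ℓ v ≠ 1 by omega,
      show ∃ w, Twin G ℓ v w from ⟨w, hw⟩]
  refine ⟨col, ?_, ?_, fun v hv hc => (hcol v hv hc).1, ?_, ?_, ?_⟩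
  · intro i hi
    simp [col, level_cycle hℓ hi]
  · intro i hi
    have hu : ∀ j, j < g → (u i = u j ↔ i = j) := fun j hj =>
      ⟨h.side_inj i hi j hj, fun h => h ▸ rfl⟩
    simp [col, h.level_side hℓ hi, hu 0 (by omega), hu 1 (by omega), hu 3 (by omega)]
  · intro v w hv ht
    rw [hcolt v w hv ht, hcolt w v (ht.level_eq ▸ hv) ht.symm]
    exact hc₀ v w ht
  · intro x y hxy hx hy hx' hy' hcx
    by_contra hcy
    rw [Bool.not_eq_false] at hcy
    obtain ⟨htx, hx0⟩ := hcol x (by omega) hcx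
    obtain ⟨hty, hy0⟩ := hcol y (by omega) hcy
    exact hc₀' x y (hMN x y ⟨⟨hxy, by omega, htx, hty⟩, hx, Or.inl ⟨hx', hy'⟩⟩)
      (hx0.trans hy0.symm)
  · intro x y hxy hx hxyl hcx hcy
    obtain ⟨htx, hx0⟩ := hcol x hx hcx
    obtain ⟨hty, hy0⟩ := hcol y (by omega) hcy
    have hwhite : ∀ x z, 2 ≤ ℓ x → c₀ x = true → N x z → col z = false := by
      intro x z hx hcx hN
      obtain ⟨-, hl, -, w, hw⟩ := hNL x z hN
      rw [hcolt z w (hl ▸ hx) hw]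
      have := hc₀' x z hN
      rw [hcx] at this
      simpa using this.symm
    obtain ⟨z, hz | hz⟩ := hmax x y ⟨hxy, hxyl, htx, hty⟩
    · exact ⟨z, Or.inl (hNL x z hz).1, hwhite x z hx hx0 hz⟩
    · exact ⟨z, Or.inr (hNL y z hz).1, hwhite y z (by omega) hy0 hz⟩

section Coloring

variable (h : IsFrame G g c u) (hℓ : IsLevel G {v | ∃ i < g, v = c i} ℓ)
  (hcol : IsFrameColoring G g c u ℓ col)
include hcol

/-- A black child has a twin, which is a white neighbor of `v`. -/
theorem _root_.SimpleGraph.IsFull.no_child {v k : V} (hv : IsFull G col v) (hk : 2 ≤ ℓ k)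
    (hvk : G.Adj v k) : ℓ v + 1 ≠ ℓ k := by
  intro hl
  obtain ⟨w, hw⟩ := hcol.exists_twin k hk (hv.2 k hvk)
  have hne := hcol.twin_ne k w hk hw
  obtain ⟨-, p, hpk, hpw⟩ := hw
  rw [← hpk.2.2 v hvk hl] at hpw
  exact hne ((hv.2 k hvk).trans (hv.2 w hpw.1).symm)

include h hℓ

/-- Without children, `u i` would have two neighbors among the other `u j`, but it has at most one,
the opposite vertex of a hexagon. -/
theorem not_isFull_side (hcub : ∀ v, G.DegThree v) {i : ℕ} (hi : i < g) :
    ¬ IsFull G col (u i) := by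
  intro hf
  have key : ∀ w, G.Adj (u i) w → w ≠ c i → ∃ j < g, w = u j := by
    intro w hw hwi
    have hl := hℓ.le_succ _ _ hw
    have hli := h.level_side hℓ hi
    refine h.exists_side_of_level hℓ ?_
    have h0 : ℓ w ≠ 0 := fun h0 => by
      obtain ⟨j, hj, rfl⟩ := (hℓ.eq_zero_iff w).mp h0
      exact hwi (by rw [h.eq_of_side_adj hi hj hw])
    have h2 : ℓ w ≠ 2 := fun h2 => hf.no_child hcol h2.ge hw (by omega)
    omega
  obtain ⟨x, y, hxy, hx, hy, hxi, hyi⟩ : ∃ x y, x ≠ y ∧ G.Adj (u i) x ∧ G.Adj (u i) y ∧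
      x ≠ c i ∧ y ≠ c i := by
    obtain ⟨x, y, z, hxy, hxz, hyz, hn⟩ := hcub (u i)
    have hc := (h.adj_side hi).symm
    rw [hn] at hc
    rcases hc with hc | hc | hc
    · exact ⟨y, z, hyz, by simp [hn], by simp [hn], hc ▸ hxy.symm, hc ▸ hxz.symm⟩
    · exact ⟨x, z, hxz, by simp [hn], by simp [hn], hc ▸ hxy, hc ▸ hyz.symm⟩
    · exact ⟨x, y, hxy, by simp [hn], by simp [hn], hc ▸ hxz, hc ▸ hyz⟩
  obtain ⟨j, hj, rfl⟩ := key x hx hxi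
  obtain ⟨k, hk, rfl⟩ := key y hy hyi
  have h1 := h.side_adj_cases hi hj hx
  have h2 := h.side_adj_cases hi hk hy
  exact hxy (by rw [show j = k by omega])

/-- On the cycle exactly `c 0`, `c 1`, `c 3` fail to be full, which leaves `c 2` without a full
neighbor. Adjacent full vertices off the cycle would lie on a common level at least 2, where
`maximal` gives one of them a white neighbor. -/
theorem isCore_iff (hcub : ∀ v, G.DegThree v) {v : V} :
    IsCore G col v ↔ ∃ i, 4 ≤ i ∧ i < g ∧ v = c i := by
  have h6 := h.six_le
  have hfull : ∀ i < g, IsFull G col (c i) ↔ i ≠ 0 ∧ i ≠ 1 ∧ i ≠ 3 := by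
    intro i hi
    rw [← hcol.side i hi]
    refine ⟨fun hf => hf.2 _ (h.adj_side hi), fun hs => ⟨hcol.cycle i hi, fun w hw => ?_⟩⟩
    rcases (h.adj_iff i hi w).mp hw with h' | h' | h'
    · rw [h', hcol.cycle _ (by unfold cycPred; split_ifs <;> omega)]
    · rw [h', hcol.cycle _ (by unfold cycSucc; split_ifs <;> omega)]
    · rw [h', hs]
  constructor
  · rintro ⟨hv, w, hvw, hw⟩
    have key : ∀ v, IsFull G col v → 1 ≤ ℓ v → 2 ≤ ℓ v := fun v hv hl => by
      by_contra hl'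
      obtain ⟨i, hi, rfl⟩ := h.exists_side_of_level hℓ (show ℓ v = 1 by omega)
      exact h.not_isFull_side hℓ hcol hcub hi hv
    by_cases h0 : ℓ v = 0
    · obtain ⟨i, hi, rfl⟩ := (hℓ.eq_zero_iff v).mp h0
      have hi' := (hfull i hi).mp hv
      refine ⟨i, ?_, hi, rfl⟩
      by_contra hlt
      have hi2 : i = 2 := by omega
      subst hi2
      rcases (h.adj_inner (by omega) (by omega) w).mp hvw with rfl | rfl | rfl
      · exact ((hfull 1 (by omega)).mp hw).2.1 rfl
      · exact ((hfull 3 (by omega)).mp hw).2.2 rfl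
      · exact h.not_isFull_side hℓ hcol hcub hi hw
    · exfalso
      have hv2 := key v hv (by omega)
      have hw2 := key w hw (by have := hℓ.le_succ _ _ hvw.symm; omega)
      have h1 := hv.no_child hcol hw2 hvw
      have h2 := hw.no_child hcol hv2 hvw.symm
      have h3 := hℓ.le_succ _ _ hvw
      have h4 := hℓ.le_succ _ _ hvw.symm
      obtain ⟨z, hz | hz, hcz⟩ := hcol.maximal v w hvw hv2 (by omega) hv.1 hw.1
      · exact absurd (hv.2 z hz) (by simp [hcz])
      · exact absurd (hw.2 z hz) (by simp [hcz])
  · rintro ⟨i, hi, hig, rfl⟩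
    refine ⟨(hfull i hig).mpr (by omega), ?_⟩
    by_cases hl : i + 1 < g
    · exact ⟨_, h.adj_succ hl, (hfull _ hl).mpr (by omega)⟩
    · have := h.adj_succ (i := i - 1) (by omega)
      rw [Nat.sub_add_cancel (by omega)] at this
      exact ⟨_, this.symm, (hfull _ (by omega)).mpr (by omega)⟩

/-- A path leaving through `c 0` is kept on the cycle by the white `u 0` and `u 1`. One leaving
through `u (g - 1)` must descend to level 2, by `hside`. From there the return through `u 4`
contradicts `cross`, and the return through `c 3` is blocked by the white `u 3` and by `hside`. -/
theorem eq_of_black_path (hside : ¬ G.Adj (u 2) (u (g - 1))) {d₀ d₁ d₂ d₃ : V}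
    (h₀ : G.Adj (c (g - 1)) d₀) (h₁ : G.Adj d₀ d₁) (h₂ : G.Adj d₁ d₂) (h₃ : G.Adj d₂ d₃)
    (h₄ : G.Adj d₃ (c 4)) (b₁ : col d₁ = true) (b₂ : col d₂ = true) (n₀₂ : d₀ ≠ d₂) (n₁₃ : d₁ ≠ d₃)
    (m₀ : ∀ i, 4 ≤ i → i < g → d₀ ≠ c i) (m₁ : ∀ i, 4 ≤ i → i < g → d₁ ≠ c i)
    (m₂ : ∀ i, 4 ≤ i → i < g → d₂ ≠ c i) (m₃ : ∀ i, 4 ≤ i → i < g → d₃ ≠ c i) :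
    d₀ = c 0 ∧ d₁ = c 1 ∧ d₂ = c 2 ∧ d₃ = c 3 := by
  have h6 := h.six_le
  have white : ∀ i, i = 0 ∨ i = 1 ∨ i = 3 → ∀ v, col v = true → v ≠ u i := by
    rintro i hi v hv rfl
    have := (hcol.side i (by omega)).mp hv
    omega
  have hne4 : u 4 ≠ u 2 := fun h' => by
    have := h.side_inj 4 (by omega) 2 (by omega) h'
    omega
  have e₃ : d₃ = c 3 ∨ d₃ = u 4 := by
    rcases (h.adj_inner (by omega) (by omega) d₃).mp h₄.symm with h' | h' | h'
    exacts [Or.inl h', absurd h' (m₃ 5 (by omega) (by omega)), Or.inr h']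
  rcases (h.adj_last d₀).mp h₀ with e₀ | e₀ | e₀
  · exact absurd e₀ (m₀ (g - 2) (by omega) (by omega))
  · rw [e₀, h.adj_zero] at h₁
    rcases h₁ with e₁ | e₁ | e₁
    · exact absurd e₁ (m₁ (g - 1) (by omega) (by omega))
    · rw [e₁, h.adj_inner (by omega) (by omega)] at h₂
      rcases h₂ with e₂ | e₂ | e₂
      · exact absurd (e₀.trans e₂.symm) n₀₂
      · rw [e₂, h.adj_inner (by omega) (by omega)] at h₃
        rcases h₃ with e₃' | e₃' | e₃'
        · exact absurd (e₁.trans e₃'.symm) n₁₃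
        · exact ⟨e₀, e₁, e₂, e₃'⟩
        · rcases e₃ with e₃ | e₃
          · exact absurd (e₃'.symm.trans e₃) (h.side_ne 2 (by omega) 3 (by omega))
          · exact absurd (e₃.symm.trans e₃') hne4
      · exact absurd e₂ (white 1 (by omega) d₂ b₂)
    · exact absurd e₁ (white 0 (by omega) d₁ b₁)
  · exfalso
    rw [e₀] at h₁
    have hone : ∀ d, G.Adj (u (g - 1)) d → col d = true → (∀ i, 4 ≤ i → i < g → d ≠ c i) →
        ℓ d = 2 := by
      intro d hd hb hm
      have hl := hℓ.le_succ _ _ hd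
      rw [h.level_side hℓ (by omega)] at hl
      have hl0 : ℓ d ≠ 0 := fun h0 => by
        obtain ⟨j, hj, rfl⟩ := (hℓ.eq_zero_iff d).mp h0
        have := h.eq_of_side_adj (by omega) hj hd
        exact hm j (by omega) hj rfl
      have hl1 : ℓ d ≠ 1 := fun h1 => by
        obtain ⟨j, hj, rfl⟩ := h.exists_side_of_level hℓ h1
        have := h.side_adj_cases (by omega) hj hd
        obtain rfl : j = 2 := by omega
        exact hside hd.symm
      omega
    have hd₁ := hone d₁ h₁ b₁ m₁
    rcases e₃ with e₃ | e₃
    · rw [e₃] at h₃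
      rcases (h.adj_inner (by omega) (by omega) d₂).mp h₃.symm with e₂ | e₂ | e₂
      · rw [e₂] at h₂
        have := h.eq_side_of_adj hℓ (by omega) h₂.symm (by omega)
        rw [this] at h₁
        exact hside h₁.symm
      · exact m₂ 4 (by omega) (by omega) e₂
      · exact white 3 (by omega) d₂ b₂ e₂
    · rw [e₃] at h₃
      have hl := hℓ.le_succ _ _ h₃.symm
      rw [h.level_side hℓ (by omega)] at hl
      have hl0 : ℓ d₂ ≠ 0 := fun h0 => by
        obtain ⟨j, hj, hj'⟩ := (hℓ.eq_zero_iff d₂).mp h0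
        have := h.eq_of_side_adj (by omega) hj (hj' ▸ h₃.symm)
        exact m₂ j (by omega) hj hj'
      have hl1 : ℓ d₂ ≠ 1 := fun h1 => by
        obtain ⟨j, hj, hj'⟩ := h.exists_side_of_level hℓ h1
        have := h.side_adj_cases (by omega) hj (hj' ▸ h₃.symm)
        -- Adjacency of `u 4` and `u j` forces `g = 6` and `j = 1`, and `u 1` is white.
        exact white j (by omega) d₂ b₂ hj'
      have := hcol.cross d₁ d₂ h₂ hd₁ (by omega) h₁.symm h₃ b₁
      rw [b₂] at this
      exact absurd this (by decide)

end Coloring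

/-- An injective image of a path cannot turn back, so its start determines it. -/
theorem _root_.SimpleGraph.map_path_eq {φ : V → V} (hφ : Function.Injective φ) {p q : ℕ → V}
    {m : ℕ} (hp : ∀ i < m, ∀ j < m, p i = p j → i = j)
    (hadj : ∀ i, i + 1 < m → G.Adj (φ (p i)) (φ (p (i + 1))))
    (hq : ∀ i < m, ∀ j < m, G.Adj (q i) (φ (p j)) →
      φ (p j) = q (i + 1) ∨ (1 ≤ i ∧ φ (p j) = q (i - 1))) (h0 : φ (p 0) = q 0) :
    ∀ i < m, φ (p i) = q i := by
  intro i
  induction i using Nat.strong_induction_on with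
  | _ i ih =>
    intro hi
    rcases i with _ | i
    · exact h0
    · have h1 := ih i (by omega) (by omega)
      have h2 := hadj i hi
      rw [h1] at h2
      rcases hq i (by omega) (i + 1) hi h2 with h | ⟨hi1, h⟩
      · exact h
      · rw [← ih (i - 1) (by omega) (by omega)] at h
        have := hp _ hi _ (by omega) (hφ h)
        omega

theorem exists_isDistinguishing (h : IsFrame G g c u) (hG : G.Connected) (h3 : G.IsSubcubic)
    (h4 : G.NoFourCycle) (hcub : ∀ v, G.DegThree v) (hside : ¬ G.Adj (u 2) (u (g - 1))) :
    ∃ col : V → Bool, IsDistinguishing G col := by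
  have h6 := h.six_le
  obtain ⟨ℓ, hℓ⟩ := hG.exists_isLevel (B := {v | ∃ i < g, v = c i}) ⟨c 0, 0, by omega, rfl⟩
  obtain ⟨col, hcol⟩ := h.exists_isFrameColoring h3 h4 hℓ
  refine ⟨col, fun φ hφ => ?_⟩
  have hcore : ∀ v, IsCore G col v ↔ ∃ i, 4 ≤ i ∧ i < g ∧ v = c i :=
    fun v => h.isCore_iff hℓ hcol hcub
  have hcoreφ : ∀ v, IsCore G col (φ v) ↔ IsCore G col v := by
    refine fun v => ⟨fun hv => ?_, fun hv => hv.map_iso φ hφ⟩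
    have := hv.map_iso φ.symm fun v => by rw [← hφ (φ.symm v), φ.apply_symm_apply]
    simpa using this
  have hmap : ∀ i, 4 ≤ i → i < g → ∃ j, 4 ≤ j ∧ j < g ∧ φ (c i) = c j := fun i hi hig =>
    (hcore _).mp ((hcoreφ _).mpr ((hcore _).mpr ⟨i, hi, hig, rfl⟩))
  have hout : ∀ i < 4, ∀ j, 4 ≤ j → j < g → φ (c i) ≠ c j := by
    intro i hi j hj hjg he
    obtain ⟨k, hk, hkg, he'⟩ := (hcore _).mp ((hcoreφ (c i)).mp ((hcore _).mpr ⟨j, hj, hjg, he⟩))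
    have := h.inj i (by omega) k hkg he'
    omega
  have hadjc : ∀ i, 4 ≤ i → i < g → ∀ j, 4 ≤ j → j < g → G.Adj (c i) (c j) →
      j = i + 1 ∨ i = j + 1 := by
    intro i hi hig j hj hjg ha
    rcases (h.adj_iff i hig _).mp ha with h' | h' | h'
    · have := h.inj _ hjg _ (by unfold cycPred; split_ifs <;> omega) h'
      unfold cycPred at this
      split_ifs at this <;> omega
    · have := h.inj _ hjg _ (by unfold cycSucc; split_ifs <;> omega) h'
      unfold cycSucc at this
      split_ifs at this <;> omega
    · exact absurd h'.symm (h.side_ne i hig j hjg)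
  have hφadj : ∀ v w, G.Adj v w → G.Adj (φ v) (φ w) := fun v w => φ.map_adj_iff.mpr
  have hinj : ∀ i j, i < g → j < g → i ≠ j → φ (c i) ≠ φ (c j) := fun i j hi hj hij he =>
    hij (h.inj i hi j hj (φ.injective he))
  -- If `c 4` went to an inner vertex of the arc, both arc neighbors of its image would have to be
  -- the image of `c 5`.
  have hends : φ (c 4) = c 4 ∨ φ (c 4) = c (g - 1) := by
    obtain ⟨i, hi, hig, he⟩ := hmap 4 le_rfl (by omega)
    by_contra! hcon
    have hi4 : i ≠ 4 := by rintro rfl; exact hcon.1 he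
    have hig' : i ≠ g - 1 := by rintro rfl; exact hcon.2 he
    have key : ∀ j, 4 ≤ j → j < g → G.Adj (c i) (c j) → φ (c 5) = c j := by
      intro j hj hjg ha
      obtain ⟨k, hk, hkg, hk'⟩ : ∃ k, 4 ≤ k ∧ k < g ∧ φ.symm (c j) = c k := by
        refine (hcore _).mp ((hcoreφ _).mp ?_)
        rw [φ.apply_symm_apply]
        exact (hcore _).mpr ⟨j, hj, hjg, rfl⟩
      have hk'' : φ (c k) = c j := by rw [← hk', φ.apply_symm_apply]
      rw [← he, ← hk'', φ.map_adj_iff] at ha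
      have := hadjc 4 le_rfl (by omega) k hk hkg ha
      rwa [show k = 5 by omega] at hk''
    have h1 := key (i + 1) (by omega) (by omega) (h.adj_succ (by omega))
    have h2 := key (i - 1) (by omega) (by omega) (by
      have := h.adj_succ (i := i - 1) (by omega)
      rw [Nat.sub_add_cancel (by omega)] at this
      exact this.symm)
    have := h.inj _ (by omega) _ (by omega) (h1.symm.trans h2)
    omega
  have hpath : ∀ q : ℕ → V, φ (c 4) = q 0 → (∀ i < g - 4, ∀ j, 4 ≤ j → j < g → G.Adj (q i) (c j) →
      c j = q (i + 1) ∨ (1 ≤ i ∧ c j = q (i - 1))) → ∀ i < g - 4, φ (c (i + 4)) = q i := by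
    intro q h0 hq
    refine map_path_eq (G := G) (p := fun i => c (i + 4)) φ.injective (fun i hi j hj he => ?_)
      (fun i hi => ?_) (fun i hi j hj ha => ?_) h0
    · have := h.inj _ (by omega) _ (by omega) he
      omega
    · have := hφadj _ _ (h.adj_succ (i := i + 4) (by omega))
      rwa [show i + 4 + 1 = i + 1 + 4 by omega] at this
    · obtain ⟨k, hk, hkg, hk'⟩ := hmap (j + 4) (by omega) (by omega)
      rw [hk'] at ha ⊢
      exact hq i hi k hk hkg ha
  have hb : ∀ i < 4, col (φ (c i)) = true := fun i hi => by rw [hφ, hcol.cycle i (by omega)]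
  rcases hends with h44 | h4g
  · have hfix := hpath (fun i => c (i + 4)) h44 fun i hi j hj hjg ha => by
      rcases hadjc (i + 4) (by omega) (by omega) j hj hjg ha with h' | h'
      · exact Or.inl (congrArg c (by omega))
      · exact Or.inr ⟨by omega, congrArg c (by omega)⟩
    have hlast : φ (c (g - 1)) = c (g - 1) := by
      have := hfix (g - 5) (by omega)
      rwa [show g - 5 + 4 = g - 1 by omega] at this
    obtain ⟨e₀, e₁, e₂, e₃⟩ := h.eq_of_black_path hℓ hcol hside
      (hlast ▸ hφadj _ _ h.adj_close) (hφadj _ _ (h.adj_succ (i := 0) (by omega)))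
      (hφadj _ _ (h.adj_succ (i := 1) (by omega))) (hφadj _ _ (h.adj_succ (i := 2) (by omega)))
      (h44 ▸ hφadj _ _ (h.adj_succ (i := 3) (by omega)))
      (hb 1 (by omega)) (hb 2 (by omega))
      (hinj 0 2 (by omega) (by omega) (by omega)) (hinj 1 3 (by omega) (by omega) (by omega))
      (hout 0 (by omega)) (hout 1 (by omega)) (hout 2 (by omega)) (hout 3 (by omega))
    refine hℓ.eq_of_fixed h4 φ ?_ fun v hv => ?_
    · rintro v ⟨i, hi, rfl⟩
      by_cases hi4 : 4 ≤ i
      · have := hfix (i - 4) (by omega)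
        rwa [Nat.sub_add_cancel hi4] at this
      · have : i = 0 ∨ i = 1 ∨ i = 2 ∨ i = 3 := by omega
        rcases this with rfl | rfl | rfl | rfl <;> assumption
    · by_cases hl : 2 ≤ ℓ v
      · exact hcol.twin_ne v _ hl hv (hφ v).symm
      · obtain ⟨hne, p, hp, hp'⟩ := hv
        have hl1 := hp.2.1
        have hl2 := hp'.2.1
        obtain ⟨i, hi, rfl⟩ := (hℓ.eq_zero_iff p).mp (by omega)
        exact hne ((h.eq_side_of_adj hℓ hi hp.1 (by omega)).trans
          (h.eq_side_of_adj hℓ hi hp'.1 (by omega)).symm)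
  · exfalso
    have hrev := hpath (fun i => c (g - 1 - i)) h4g fun i hi j hj hjg ha => by
      rcases hadjc (g - 1 - i) (by omega) (by omega) j hj hjg ha with h' | h'
      · exact Or.inr ⟨by omega, congrArg c (by omega)⟩
      · exact Or.inl (congrArg c (by omega))
    have hlast : φ (c (g - 1)) = c 4 := by
      have := hrev (g - 5) (by omega)
      rwa [show g - 5 + 4 = g - 1 by omega, show g - 1 - (g - 5) = 4 by omega] at this
    obtain ⟨e₃, e₂, e₁, e₀⟩ := h.eq_of_black_path hℓ hcol hside
      (h4g ▸ (hφadj _ _ (h.adj_succ (i := 3) (by omega))).symm)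
      (hφadj _ _ (h.adj_succ (i := 2) (by omega))).symm
      (hφadj _ _ (h.adj_succ (i := 1) (by omega))).symm
      (hφadj _ _ (h.adj_succ (i := 0) (by omega))).symm
      (hlast ▸ (hφadj _ _ h.adj_close).symm)
      (hb 2 (by omega)) (hb 1 (by omega))
      (hinj 3 1 (by omega) (by omega) (by omega)) (hinj 2 0 (by omega) (by omega) (by omega))
      (hout 3 (by omega)) (hout 2 (by omega)) (hout 1 (by omega)) (hout 0 (by omega))
    -- A reflection exchanges `c 1` and `c 2`, hence sends the white `u 1` to the black `u 2`.
    have hu := hφadj _ _ (h.adj_side (i := 1) (by omega))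
    rw [e₁, h.adj_inner (by omega) (by omega)] at hu
    rcases hu with hu | hu | hu
    · exact h.side_ne 1 (by omega) 2 (by omega) (φ.injective (hu.trans e₂.symm))
    · exact h.side_ne 1 (by omega) 0 (by omega) (φ.injective (hu.trans e₀.symm))
    · have h1 := hφ (u 1)
      rw [hu, (hcol.side 2 (by omega)).mpr (by omega)] at h1
      exact ((hcol.side 1 (by omega)).mp h1.symm).2.1 rfl

end IsFrame

/-! ### The Heawood graph -/

/-- The neighbors of a vertex of the Heawood graph, presented as a hexagon, its six side vertices
and two further vertices. -/
def heawoodNeighbor : Fin 6 ⊕ Fin 6 ⊕ Fin 2 → Fin 3 → Fin 6 ⊕ Fin 6 ⊕ Fin 2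
  | .inl i => ![.inl (i - 1), .inl (i + 1), .inr (.inl i)]
  | .inr (.inl i) => ![.inl i, .inr (.inl (i + 3)), .inr (.inr ⟨i % 2, Nat.mod_lt _ two_pos⟩)]
  | .inr (.inr b) =>
    ![.inr (.inl ⟨b, by omega⟩), .inr (.inl ⟨b + 2, by omega⟩), .inr (.inl ⟨b + 4, by omega⟩)]

/-- An asymmetric coloring of the Heawood graph. -/
def heawoodColoring : Fin 6 ⊕ Fin 6 ⊕ Fin 2 → Bool
  | .inl i => decide (i < 4)
  | .inr (.inl i) => decide (i = 4)
  | .inr (.inr _) => false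

/-- The `k`-th refinement of the coloring. -/
def heawoodRefine : ℕ → Fin 6 ⊕ Fin 6 ⊕ Fin 2 → ℕ
  | 0, v => (heawoodColoring v).toNat
  | k + 1, v => heawoodRefine k v + ∑ j, heawoodRefine k (heawoodNeighbor v j) ^ 2

theorem heawoodNeighbor_injective : ∀ v, Function.Injective (heawoodNeighbor v) := by
  decide

/-- Two rounds of refinement already give all 14 vertices different values, so nothing moves under
an automorphism preserving the coloring. -/
theorem heawoodRefine_injective : Function.Injective (heawoodRefine 2) := by
  decide +kernel

theorem exists_isDistinguishing_of_heawood {e : Fin 6 ⊕ Fin 6 ⊕ Fin 2 → V}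
    (he : Function.Bijective e) (hadj : ∀ t w, G.Adj (e t) w ↔ ∃ j, w = e (heawoodNeighbor t j)) :
    ∃ c : V → Bool, IsDistinguishing G c := by
  let ε := Equiv.ofBijective e he
  refine ⟨fun v => heawoodColoring (ε.symm v), fun φ hφ => ?_⟩
  let σ := fun t => ε.symm (φ (e t))
  have hσ : ∀ t, e (σ t) = φ (e t) := fun t => ε.apply_symm_apply _
  have hσinj : Function.Injective σ := fun a b h =>
    he.1 (φ.injective (ε.symm.injective h))
  have himage : ∀ t, Finset.univ.image (heawoodNeighbor (σ t)) =
      (Finset.univ.image (heawoodNeighbor t)).image σ := by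
    intro t
    ext s
    have h1 : s ∈ Finset.univ.image (heawoodNeighbor (σ t)) ↔ G.Adj (φ (e t)) (e s) := by
      rw [← hσ, hadj]
      simp only [Finset.mem_image, Finset.mem_univ, true_and, he.1.eq_iff, eq_comm]
    have h2 : ∀ r, r ∈ Finset.univ.image (heawoodNeighbor t) ↔ G.Adj (e t) (e r) := by
      intro r
      rw [hadj]
      simp only [Finset.mem_image, Finset.mem_univ, true_and, he.1.eq_iff, eq_comm]
    rw [h1, Finset.mem_image]
    constructor
    · intro h
      refine ⟨ε.symm (φ.symm (e s)), ?_, ?_⟩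
      · rw [h2, ← φ.map_adj_iff]
        show G.Adj (φ (e t)) (φ (ε (ε.symm (φ.symm (e s)))))
        simpa using h
      · apply he.1
        rw [hσ]
        show φ (ε (ε.symm (φ.symm (e s)))) = e s
        simp
    · rintro ⟨r, hr, rfl⟩
      rw [h2] at hr
      rw [hσ]
      exact φ.map_adj_iff.mpr hr
  have hinv : ∀ k t, heawoodRefine k (σ t) = heawoodRefine k t := by
    intro k
    induction k with
    | zero =>
      intro t
      have : heawoodColoring (σ t) = heawoodColoring (ε.symm (e t)) := hφ (e t)
      rw [show ε.symm (e t) = t from ε.symm_apply_apply t] at this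
      exact congrArg Bool.toNat this
    | succ k ih =>
      intro t
      have hsum : ∀ s, ∑ j, heawoodRefine k (heawoodNeighbor s j) ^ 2 =
          ∑ r ∈ Finset.univ.image (heawoodNeighbor s), heawoodRefine k r ^ 2 := fun s => by
        rw [Finset.sum_image (heawoodNeighbor_injective s).injOn]
      simp only [heawoodRefine, ih, hsum, himage]
      rw [Finset.sum_image hσinj.injOn]
      simp only [ih]
  intro v
  obtain ⟨t, rfl⟩ := he.2 v
  rw [← hσ, heawoodRefine_injective (hinv 2 t)]

/-- On every 6-cycle, the outer neighbors of opposite vertices are adjacent. -/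
def OppositeJoined (G : SimpleGraph V) : Prop :=
  ∀ f u, IsFrame G 6 f u → G.Adj (u 2) (u 5)

/-- Applying the hypothesis to further hexagons determines all adjacencies: the third neighbors of
the `U i` coincide for equal parity of `i`, and the 14 vertices obtained are closed under adjacency.
-/
theorem exists_isDistinguishing_of_oppositeJoined (hG : G.Connected) (h6 : G.GirthSix)
    (hcub : ∀ v, G.DegThree v) (hop : G.OppositeJoined) {c u : ℕ → V} (h : IsFrame G 6 c u) :
    ∃ c : V → Bool, IsDistinguishing G c := by
  have h4 := h6.noFourCycle
  have hframe : ∀ f, IsCyc G 6 f → ∀ x y, G.Adj (f 2) x → x ≠ f 1 → x ≠ f 3 → G.Adj (f 5) y →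
      y ≠ f 4 → y ≠ f 0 → G.Adj x y := by
    intro f hf x y hx hx1 hx3 hy hy4 hy0
    obtain ⟨w, hw⟩ := hf.exists_isFrame (fun n f' hf' => h6 n f' hf') h6 hcub
    rw [hw.adj_inner (by omega) (by omega)] at hx
    have hy' := (hw.adj_last y).mp hy
    rw [hx.resolve_left hx1 |>.resolve_left hx3, hy'.resolve_left hy4 |>.resolve_left hy0]
    exact hop f w hw
  have hhex : ∀ a b c d e f : V, [a, b, c, d, e, f].Nodup → G.Adj a b → G.Adj b c → G.Adj c d →
      G.Adj d e → G.Adj e f → G.Adj f a → ∀ x y, G.Adj c x → x ≠ b → x ≠ d → G.Adj f y → y ≠ e →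
      y ≠ a → G.Adj x y := by
    intro a b c d e f hn hab hbc hcd hde hef hfa x y
    exact hframe _ (isCyc_of_list (G := G) a [a, b, c, d, e, f] (by simp) hn
      (by simp [hab, hbc, hcd, hde, hef]) (by simpa using hfa)) x y
  let C : Fin 6 → V := fun i => c i
  let U : Fin 6 → V := fun i => u i
  have hCinj : Function.Injective C := fun i j hij => Fin.ext (h.inj i i.2 j j.2 hij)
  have hUinj : Function.Injective U := fun i j hij => Fin.ext (h.side_inj i i.2 j j.2 hij)
  have hUC : ∀ i j, U i ≠ C j := fun i j => h.side_ne i i.2 j j.2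
  have hCadj : ∀ i w, G.Adj (C i) w ↔ w = C (i - 1) ∨ w = C (i + 1) ∨ w = U i := by
    intro i w
    have h1 : ∀ i : Fin 6, cycPred 6 i = (i - 1 : Fin 6) ∧ cycSucc 6 i = (i + 1 : Fin 6) := by
      decide
    rw [h.adj_iff i i.2, (h1 i).1, (h1 i).2]
  have hstep : ∀ i, G.Adj (C i) (C (i + 1)) := fun i => (hCadj i _).mpr (Or.inr (Or.inl rfl))
  have hCU : ∀ i, G.Adj (C i) (U i) := fun i => (hCadj i _).mpr (Or.inr (Or.inr rfl))
  have hCU' : ∀ i j, G.Adj (U i) (C j) → j = i := by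
    intro i j hij
    rcases (hCadj j _).mp hij.symm with h' | h' | h'
    exacts [absurd h' (hUC _ _), absurd h' (hUC _ _), (hUinj h').symm]
  have hopp : ∀ i, G.Adj (U i) (U (i + 3)) := by
    intro i
    have hs : ∀ j k, j + 1 = k → G.Adj (C j) (C k) := fun j k hjk => hjk ▸ hstep j
    exact hhex (C (i - 2)) (C (i - 1)) (C i) (C (i + 1)) (C (i + 2)) (C (i + 3))
      (List.Nodup.map hCinj (l := [i - 2, i - 1, i, i + 1, i + 2, i + 3]) (by revert i; decide))
      (hs _ _ (by revert i; decide)) (hs _ _ (by revert i; decide)) (hs _ _ (by revert i; decide))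
      (hs _ _ (by revert i; decide)) (hs _ _ (by revert i; decide)) (hs _ _ (by revert i; decide))
      _ _ (hCU i) (hUC _ _) (hUC _ _) (hCU _) (hUC _ _) (hUC _ _)
  have hUU' : ∀ i j, G.Adj (U i) (U j) → j = i + 3 := by
    intro i j hij
    have := h.side_adj_cases i.2 j.2 hij
    omega
  have hthird : ∀ i, ∃ x, x ≠ C i ∧ x ≠ U (i + 3) ∧
      ∀ w, G.Adj (U i) w ↔ w = C i ∨ w = U (i + 3) ∨ w = x := fun i =>
    (hcub (U i)).exists_third (hCU i).symm (hopp i) (hUC _ _).symm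
  choose X hXC hXU hX using hthird
  have hUX : ∀ i, G.Adj (U i) (X i) := fun i => (hX i _).mpr (Or.inr (Or.inr rfl))
  have hXC' : ∀ i j, X i ≠ C j := by
    intro i j hij
    have := hUX i
    rw [hij] at this
    exact hXC i (by rw [hij, hCU' i j this])
  have hXU' : ∀ i j, X i ≠ U j := by
    intro i j hij
    have := hUX i
    rw [hij] at this
    exact hXU i (by rw [hij, hUU' i j this])
  have hX2 : ∀ i, X i = X (i + 2) := by
    intro i
    have hs : ∀ j k, j + 1 = k → G.Adj (C j) (C k) := fun j k hjk => hjk ▸ hstep j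
    have hn : (i ≠ i + 1 ∧ i ≠ i + 2 ∧ i ≠ i + 3) ∧ (i + 1 ≠ i + 2 ∧ i + 1 ≠ i + 3) ∧
      i + 2 ≠ i + 3 ∧ i + 3 ≠ i := by revert i; decide
    -- In this hexagon `C (i + 2)` and `U i` are opposite, with outer neighbors `U (i + 2)` and `X
    -- i`.
    have := hhex (C i) (C (i + 1)) (C (i + 2)) (C (i + 3)) (U (i + 3)) (U i)
      (by
        have hUC'' : ∀ i j, C i ≠ U j := fun i j => (hUC j i).symm
        simp only [List.nodup_cons, List.mem_cons, List.not_mem_nil, or_false, not_or,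
          hCinj.eq_iff, hUinj.eq_iff, hUC'', not_false_eq_true, List.nodup_nil, and_true]
        tauto)
      (hstep i) (hs _ _ (by revert i; decide)) (hs _ _ (by revert i; decide)) (hCU _)
      (hopp i).symm (hCU i).symm (U (i + 2)) (X i) (hCU _) (hUC _ _) (hUC _ _) (hUX i) (hXU i)
      (hXC i)
    rcases (hX (i + 2) _).mp this with h' | h' | h'
    exacts [absurd h' (hXC' _ _), absurd h' (hXU' _ _), h']
  let Y : Fin 2 → V := fun b => X ⟨b, by omega⟩
  have hXY : ∀ i : Fin 6, X i = Y ⟨i % 2, Nat.mod_lt _ two_pos⟩ := by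
    have h0 : X 0 = Y 0 := rfl
    have h1 : X 1 = Y 1 := rfl
    have h2 : X 2 = Y 0 := (hX2 0).symm
    have h3 : X 3 = Y 1 := (hX2 1).symm
    have h4 : X 4 = Y 0 := (hX2 2).symm.trans h2
    have h5 : X 5 = Y 1 := (hX2 3).symm.trans h3
    intro i
    fin_cases i
    exacts [h0, h1, h2, h3, h4, h5]
  have hYadj : ∀ (b : Fin 2) (w : V), G.Adj (Y b) w ↔
      w = U ⟨b, by omega⟩ ∨ w = U ⟨b + 2, by omega⟩ ∨ w = U ⟨b + 4, by omega⟩ := by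
    intro b
    have hYU : ∀ i : Fin 6, (⟨i % 2, Nat.mod_lt _ two_pos⟩ : Fin 2) = b → G.Adj (Y b) (U i) := by
      intro i hi
      rw [← hi, ← hXY]
      exact (hUX i).symm
    have ha := hYU ⟨b, by omega⟩ (Fin.ext (by simp; omega))
    have hb := hYU ⟨b + 2, by omega⟩ (Fin.ext (by simp; omega))
    have hc := hYU ⟨b + 4, by omega⟩ (Fin.ext (by simp; omega))
    obtain ⟨z, -, -, hz⟩ := (hcub (Y b)).exists_third ha hb
      (hUinj.ne (by simp [Fin.ext_iff]))
    have hcz := ((hz _).mp hc).resolve_left (hUinj.ne (by simp [Fin.ext_iff]))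
      |>.resolve_left (hUinj.ne (by simp [Fin.ext_iff]))
    rwa [← hcz] at hz
  have hYinj : Function.Injective Y := by
    have h01 : Y 0 ≠ Y 1 := by
      intro h01
      have h0 : G.Adj (Y 0) (U 0) := (hYadj 0 _).mpr (Or.inl rfl)
      rw [h01, hYadj] at h0
      rcases h0 with h0 | h0 | h0 <;> exact absurd (hUinj h0) (by decide)
    intro a b hab
    fin_cases a <;> fin_cases b
    exacts [rfl, absurd hab h01, absurd hab.symm h01, rfl]
  let e : Fin 6 ⊕ Fin 6 ⊕ Fin 2 → V := Sum.elim C (Sum.elim U Y)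
  have hadj : ∀ t w, G.Adj (e t) w ↔ ∃ j, w = e (heawoodNeighbor t j) := by
    rintro (i | i | b) w
    · simp only [Fin.exists_fin_succ, Fin.exists_fin_zero]
      exact (hCadj i w).trans (by simp [e, heawoodNeighbor])
    · exact (hX i w).trans (by simp [e, heawoodNeighbor, hXY, Fin.exists_fin_succ])
    · exact (hYadj b w).trans (by simp [e, heawoodNeighbor, Fin.exists_fin_succ])
  refine exists_isDistinguishing_of_heawood (e := e) ⟨?_, fun v => ?_⟩ hadj
  · exact hCinj.sumElim (hUinj.sumElim hYinj fun i b => (hXU' _ i).symm)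
      fun i s => by
        rcases s with j | b
        · exact (hUC j i).symm
        · exact (hXC' _ i).symm
  · refine hG.forall_of_adj_closed (P := fun v => ∃ t, e t = v) (v₀ := e (.inl 0)) ⟨_, rfl⟩ ?_ v
    rintro _ w hvw ⟨t, rfl⟩
    obtain ⟨j, rfl⟩ := (hadj t w).mp hvw
    exact ⟨_, rfl⟩

/-! ### Minimum degree two and the 2-core -/

theorem exists_isDistinguishing_of_minDegTwo (hG : G.Connected) (h2 : G.MinDegTwo)
    (h3 : G.IsSubcubic) (h6 : G.GirthSix) (hex : ∃ n f, IsCyc G n f) :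
    ∃ c : V → Bool, IsDistinguishing G c := by
  classical
  have h4 := h6.noFourCycle
  by_cases hall : ∀ v, G.DegTwo v
  · obtain ⟨n, f, hf⟩ := hex
    exact exists_isDistinguishing_of_forall_degTwo hG hall hf (h6 n f hf)
  obtain ⟨z, hz⟩ := not_forall.mp hall
  by_cases hiso : ∀ x y, G.DegTwo x → G.Adj x y → ¬ G.DegTwo y
  swap
  · push Not at hiso
    obtain ⟨x, y, hx, hxy, hy⟩ := hiso
    obtain ⟨r, s, t, hr, hs, ht, hs2, ht2⟩ := hG.exists_degTwo_between hx hy hxy hz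
    exact exists_isDistinguishing_of_adj_degTwo hG h3 h4 (fun a b c => h6.not_adj) hr hs ht hs2 ht2
  by_cases hr : ∃ r, G.DegTwo r
  · obtain ⟨r, hr⟩ := hr
    exact exists_isDistinguishing_of_isolated_degTwo hG h2 h3 h4 hiso hr
  have hcub : ∀ v, G.DegThree v := fun v => h2.degThree h3 fun hv => hr ⟨v, hv⟩
  by_cases hop : G.OppositeJoined
  · obtain ⟨c, hc⟩ := Nat.find_spec hex
    obtain ⟨u, hu⟩ := hc.exists_isFrame (fun n f hf => Nat.find_min' hex ⟨f, hf⟩) h6 hcub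
    generalize Nat.find hex = g at hu
    by_cases hg : g = 6
    · subst hg
      exact exists_isDistinguishing_of_oppositeJoined hG h6 hcub hop hu
    · have := hu.six_le
      exact hu.exists_isDistinguishing hG h3 h4 hcub fun ha =>
        hg (hu.side_adj_cases (by omega) (by omega) ha).1
  · unfold OppositeJoined at hop
    push Not at hop
    obtain ⟨f, u, hu, ha⟩ := hop
    exact hu.exists_isDistinguishing hG h3 h4 hcub ha

/-- The largest set of vertices that induces a subgraph of minimum degree at least two. -/
def twoCore (G : SimpleGraph V) : Set V :=
  {v | ∃ S : Set V, v ∈ S ∧ ∀ x ∈ S, ∃ a ∈ S, ∃ b ∈ S, a ≠ b ∧ G.Adj x a ∧ G.Adj x b}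

theorem exists_adj_of_mem_twoCore {v : V} (hv : v ∈ G.twoCore) :
    ∃ a ∈ G.twoCore, ∃ b ∈ G.twoCore, a ≠ b ∧ G.Adj v a ∧ G.Adj v b := by
  obtain ⟨S, hvS, hS⟩ := hv
  obtain ⟨a, ha, b, hb, h⟩ := hS v hvS
  exact ⟨a, ⟨S, ha, hS⟩, b, ⟨S, hb, hS⟩, h⟩

theorem map_mem_twoCore (φ : G ≃g G) {v : V} (hv : v ∈ G.twoCore) : φ v ∈ G.twoCore := by
  obtain ⟨S, hvS, hS⟩ := hv
  refine ⟨φ '' S, ⟨v, hvS, rfl⟩, ?_⟩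
  rintro _ ⟨x, hx, rfl⟩
  obtain ⟨a, ha, b, hb, hab, h1, h2⟩ := hS x hx
  exact ⟨φ a, ⟨a, ha, rfl⟩, φ b, ⟨b, hb, rfl⟩, φ.injective.ne hab, φ.map_adj_iff.mpr h1,
    φ.map_adj_iff.mpr h2⟩

theorem map_mem_twoCore_iff (φ : G ≃g G) {v : V} : φ v ∈ G.twoCore ↔ v ∈ G.twoCore :=
  ⟨fun h => by simpa using map_mem_twoCore φ.symm h, map_mem_twoCore φ⟩

theorem IsCyc.mem_twoCore {n : ℕ} {f : ℕ → V} (hf : IsCyc G n f) {i : ℕ} (hi : i < n) :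
    f i ∈ G.twoCore := by
  have h3 := hf.three_le
  refine ⟨f '' {i | i < n}, ⟨i, hi, rfl⟩, ?_⟩
  rintro _ ⟨j, hj, rfl⟩
  rw [Set.mem_ofPred_eq] at hj
  have key : ∀ a b, a < n → b < n → a ≠ b → G.Adj (f j) (f a) → G.Adj (f j) (f b) →
      ∃ x ∈ f '' {i | i < n}, ∃ y ∈ f '' {i | i < n}, x ≠ y ∧ G.Adj (f j) x ∧ G.Adj (f j) y :=
    fun a b ha hb hab h1 h2 => ⟨f a, ⟨a, ha, rfl⟩, f b, ⟨b, hb, rfl⟩,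
      fun h => hab (hf.inj a ha b hb h), h1, h2⟩
  have hpred : 0 < j → G.Adj (f j) (f (j - 1)) := fun h0 => by
    have := hf.adj (j - 1) (by omega)
    rw [Nat.sub_add_cancel h0] at this
    exact this.symm
  rcases Nat.eq_zero_or_pos j with rfl | h0
  · exact key (n - 1) 1 (by omega) (by omega) (by omega) hf.close.symm (hf.adj 0 (by omega))
  · by_cases hl : j + 1 < n
    · exact key (j - 1) (j + 1) (by omega) hl (by omega) (hpred h0) (hf.adj j hl)
    · refine key (j - 1) 0 (by omega) (by omega) (by omega) (hpred h0) ?_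
      have := hf.close
      rwa [show n - 1 = j by omega] at this

/-- Adding the path to the core keeps degrees at least two, as inner path vertices have two
neighbors on the path. This makes the core connected. -/
theorem support_subset_twoCore {v w : V} (hv : v ∈ G.twoCore) (hw : w ∈ G.twoCore)
    {p : G.Walk v w} (hp : p.IsPath) : ∀ x ∈ p.support, x ∈ G.twoCore := by
  intro x hx
  refine ⟨G.twoCore ∪ {x | x ∈ p.support}, Or.inr hx, fun y hy => ?_⟩
  by_cases hyc : y ∈ G.twoCore
  · obtain ⟨a, ha, b, hb, h⟩ := exists_adj_of_mem_twoCore hyc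
    exact ⟨a, Or.inl ha, b, Or.inl hb, h⟩
  · obtain ⟨i, rfl, hi⟩ := Walk.mem_support_iff_exists_getVert.mp (hy.resolve_left hyc)
    have h0 : i ≠ 0 := by
      rintro rfl
      exact hyc (by rwa [Walk.getVert_zero])
    have hl : i ≠ p.length := by
      rintro rfl
      exact hyc (by rwa [Walk.getVert_length])
    refine ⟨p.getVert (i - 1), Or.inr (p.getVert_mem_support _), p.getVert (i + 1),
      Or.inr (p.getVert_mem_support _), fun h => ?_, ?_, p.adj_getVert_succ (by omega)⟩
    · have := hp.getVert_injOn (show i - 1 ≤ p.length by omega) (show i + 1 ≤ p.length by omega) h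
      omega
    · have := p.adj_getVert_succ (i := i - 1) (by omega)
      rw [Nat.sub_add_cancel (by omega)] at this
      exact this.symm

theorem Connected.induce_twoCore (hG : G.Connected) {v : V} (hv : v ∈ G.twoCore) :
    (G.induce G.twoCore).Connected := by
  classical
  have : Nonempty G.twoCore := ⟨⟨v, hv⟩⟩
  refine ⟨fun a b => ?_⟩
  obtain ⟨p⟩ := hG.preconnected a b
  exact ⟨p.toPath.1.induce _ (support_subset_twoCore a.2 b.2 p.toPath.2)⟩

/-- Automorphisms preserve the core, where a distinguishing coloring is already available; outside
it, separating twins is enough. -/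
theorem exists_isDistinguishing_of_girthSix (hG : G.Connected) (h3 : G.IsSubcubic)
    (h6 : G.GirthSix) (hex : ∃ n f, IsCyc G n f) : ∃ c : V → Bool, IsDistinguishing G c := by
  classical
  obtain ⟨n, f, hf⟩ := hex
  have hn := hf.three_le
  have hf0 : f 0 ∈ G.twoCore := hf.mem_twoCore (by omega)
  set K := G.twoCore with hK
  obtain ⟨cK, hcK⟩ : ∃ c : K → Bool, IsDistinguishing (G.induce K) c := by
    refine exists_isDistinguishing_of_minDegTwo (hG.induce_twoCore hf0) ?_ ?_ ?_ ?_
    · rintro ⟨v, hv⟩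
      obtain ⟨a, ha, b, hb, hab, h1, h2⟩ := exists_adj_of_mem_twoCore hv
      exact ⟨⟨a, ha⟩, ⟨b, hb⟩, fun h => hab (congrArg Subtype.val h), h1, h2⟩
    · intro v a b c d ha hb hc hd
      simpa only [Subtype.ext_iff] using h3 v a b c d ha hb hc hd
    · intro m f' hf'
      exact h6 m (fun i => f' i) ⟨hf'.three_le, fun i hi j hj h =>
        hf'.inj i hi j hj (Subtype.ext h), fun i hi => hf'.adj i hi, hf'.close⟩
    -- Indices from `n` on are sent to 0, since nothing is known about `f` there.
    · have hmem : ∀ i, f (if i < n then i else 0) ∈ K := fun i =>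
        hf.mem_twoCore (by split_ifs <;> omega)
      refine ⟨n, fun i => ⟨f (if i < n then i else 0), hmem i⟩, hn, ?_, ?_, ?_⟩
      · intro i hi j hj h
        have := congrArg Subtype.val h
        simp only [if_pos hi, if_pos hj] at this
        exact hf.inj i hi j hj this
      · intro i hi
        show G.Adj (f (if i < n then i else 0)) (f (if i + 1 < n then i + 1 else 0))
        simpa only [if_pos (show i < n by omega), if_pos hi] using hf.adj i hi
      · show G.Adj (f (if n - 1 < n then n - 1 else 0)) (f (if 0 < n then 0 else 0))
        simpa only [if_pos (show n - 1 < n by omega), if_pos (show 0 < n by omega)] using hf.close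
  obtain ⟨ℓ, hℓ⟩ := hG.exists_isLevel (B := K) ⟨_, hf0⟩
  have hR : IsPairing (Twin G ℓ) := by
    refine hℓ.twin_isPairing h3 ?_
    rintro p hp x y z hx hy - hxK hyK -
    obtain ⟨a, ha, b, hb, hab, h1, h2⟩ := exists_adj_of_mem_twoCore hp
    rcases h3 p x y a b hx hy h1 h2 with h | h | h | h | h | h
    · exact Or.inl h
    all_goals first
      | exact absurd h hab
      | (subst h; contradiction)
  obtain ⟨c₀, hc₀, -⟩ := exists_bool_coloring_of_pairings hR hR
  refine ⟨fun v => if h : v ∈ K then cK ⟨v, h⟩ else c₀ v, fun φ hφ => ?_⟩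
  have hφK : ∀ v, φ v ∈ K ↔ v ∈ K := fun v => map_mem_twoCore_iff φ
  let ψ : G.induce K ≃g G.induce K :=
    { toEquiv := φ.toEquiv.subtypeEquiv fun v => (hφK v).symm
      map_rel_iff' := φ.map_adj_iff }
  refine hℓ.eq_of_fixed h6.noFourCycle φ (fun v hv => ?_) fun u hu => hc₀ _ _ hu ?_
  · have := hcK ψ (fun w => ?_) ⟨v, hv⟩
    · exact congrArg Subtype.val this
    · have h := hφ w
      have hw : φ w ∈ K := (hφK w).mpr w.2
      simp only [dif_pos hw, dif_pos w.2] at h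
      exact h
  · have hu0 : u ∉ K := fun h => hu.level_pos.ne' ((hℓ.eq_zero_iff u).mpr h)
    have h := hφ u
    simp only [dif_neg hu0, dif_neg (mt (hφK u).mp hu0)] at h
    exact h.symm

/-! ### Girth, valence and the distinguishing number -/

theorem exists_isCyc_of_not_isAcyclic (h : ¬ G.IsAcyclic) : ∃ n f, IsCyc G n f := by
  unfold IsAcyclic at h
  push Not at h
  obtain ⟨v, p, hp⟩ := h
  have h3 := hp.three_le_length
  refine ⟨p.length, p.getVert, h3, fun i hi j hj hij => ?_,
    fun i hi => p.adj_getVert_succ (by omega), ?_⟩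
  · exact hp.getVert_injOn' (show i ≤ p.length - 1 by omega) (show j ≤ p.length - 1 by omega) hij
  · have := p.adj_getVert_succ (i := p.length - 1) (by omega)
    rw [Nat.sub_add_cancel (by omega), Walk.getVert_length] at this
    rwa [Walk.getVert_zero]

theorem IsCyc.egirth_le {n : ℕ} {f : ℕ → V} (hf : IsCyc G n f) : G.egirth ≤ n := by
  have h3 := hf.three_le
  have hwalk : ∀ k < n, ∃ p : G.Walk (f 0) (f k), p.IsPath ∧ p.length = k ∧
      (∀ x ∈ p.support, ∃ i ≤ k, x = f i) ∧ ∀ e ∈ p.edges, ∃ i < k, e = s(f i, f (i + 1)) := by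
    intro k
    induction k with
    | zero => exact fun _ => ⟨Walk.nil, by simp⟩
    | succ k ih =>
      intro hk
      obtain ⟨p, hp, hl, hs, he⟩ := ih (by omega)
      refine ⟨p.concat (hf.adj k hk), hp.concat (fun hmem => ?_) _, by simp [hl], ?_, ?_⟩
      · obtain ⟨i, hi, hif⟩ := hs _ hmem
        have := hf.inj _ hk _ (by omega) hif
        omega
      · intro x hx
        rw [Walk.support_concat, List.mem_append, List.mem_singleton] at hx
        rcases hx with hx | rfl
        · obtain ⟨i, hi, h⟩ := hs x hx
          exact ⟨i, by omega, h⟩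
        · exact ⟨k + 1, le_rfl, rfl⟩
      · intro e hx
        rw [Walk.edges_concat, List.concat_eq_append, List.mem_append, List.mem_singleton] at hx
        rcases hx with hx | rfl
        · obtain ⟨i, hi, h⟩ := he e hx
          exact ⟨i, by omega, h⟩
        · exact ⟨k, by omega, rfl⟩
  obtain ⟨p, hp, hl, -, he⟩ := hwalk (n - 1) (by omega)
  have hc : (Walk.cons hf.close p).IsCycle := by
    rw [Walk.cons_isCycle_iff]
    refine ⟨hp, fun hmem => ?_⟩
    obtain ⟨i, hi, h⟩ := he _ hmem
    rw [Sym2.eq_iff] at h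
    rcases h with ⟨h1, -⟩ | ⟨h1, h2⟩
    · have := hf.inj _ (by omega) _ (by omega) h1
      omega
    · have := hf.inj _ (by omega) _ (by omega) h1
      have := hf.inj _ (by omega) _ (by omega) h2
      omega
  have := le_egirth.mp le_rfl _ _ hc
  rwa [Walk.length_cons, hl, Nat.sub_add_cancel (by omega)] at this

theorem isSubcubic_of_encard_le (h : ∀ v, (G.neighborSet v).encard ≤ 3) : G.IsSubcubic := by
  intro v a b c d ha hb hc hd
  by_contra! hne
  obtain ⟨hab, hac, had, hbc, hbd, hcd⟩ := hne
  have hsub : ({a, b, c, d} : Set V) ⊆ G.neighborSet v := by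
    rintro x (rfl | rfl | rfl | rfl) <;> assumption
  have h4 : ({a, b, c, d} : Set V).encard = 4 := by
    rw [Set.encard_insert_of_notMem (by simp [*]), Set.encard_insert_of_notMem (by simp [*]),
      Set.encard_pair hcd]
    norm_num
  have := (Set.encard_le_encard hsub).trans (h v)
  rw [h4] at this
  exact absurd this (by decide)

end SimpleGraph

theorem distinguishingNumber_le {V : Type*} {G : SimpleGraph V} {k : ℕ} {c : V → Fin k}
    (hc : IsDistinguishing G c) : distinguishingNumber G ≤ k :=
  iInf₂_le k ⟨c, hc⟩

theorem corollary2p5 {V : Type*} (G : SimpleGraph V)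
    (hconn : G.Connected) (hval : HasMaxValence G 3)
    (hcycle : ¬ G.IsAcyclic) (hgirth : 6 ≤ G.egirth) :
    distinguishingNumber G ≤ 2 ∧
      (distinguishingNumber G = 2 ↔ ∃ φ : G ≃g G, ∃ v, φ v ≠ v) := by
  have hle : distinguishingNumber G ≤ 2 := by
    obtain ⟨c, hc⟩ := G.exists_isDistinguishing_of_girthSix hconn
      (SimpleGraph.isSubcubic_of_encard_le (by exact_mod_cast hval.1))
      (fun n f hf => by exact_mod_cast hgirth.trans hf.egirth_le)
      (SimpleGraph.exists_isCyc_of_not_isAcyclic hcycle)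
    exact distinguishingNumber_le (k := 2) (c := fun v => finTwoEquiv.symm (c v))
      fun φ hφ => hc φ fun v => finTwoEquiv.symm.injective (hφ v)
  refine ⟨hle, fun h2 => ?_, fun ⟨φ, v, hv⟩ => le_antisymm hle ?_⟩
  -- Without nontrivial automorphisms a constant coloring is distinguishing.
  · by_contra! hcon
    have := distinguishingNumber_le (G := G) (k := 1) (c := fun _ => 0) fun φ _ => hcon φ
    rw [h2] at this
    exact absurd this (by decide)
  · refine le_iInf₂ fun k ⟨c, hc⟩ => ?_
    by_contra! hk
    have hk2 : k < 2 := by exact_mod_cast hk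
    have hsub : Subsingleton (Fin k) := by
      rw [Fin.subsingleton_iff_le_one]
      omega
    exact hv (hc φ (fun w => Subsingleton.elim _ _) v)
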